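/- Let $(A,\mathfrak m)$ be a one-dimensional Cohen--Macaulay (Noetherian) local ring with infinite residue field, multiplicity $e$ and embedding dimension $b=\mu(\mathfrak m)$. Here $e$ is the integer with $\sum_{i=0}^{n}\lambda(\mathfrak m^i/\mathfrak m^{i+1})=e(n+1)-\rho$ for some integer $\rho$ and all large $n$, where $\lambda$ denotes length. The reduction number of $A$ is the least $r$ with $\mathfrak m^{r+1}=y\mathfrak m^r$, where $yA$ is a minimal reduction of $\mathfrak m$ (it does not depend on $y$). Assume that $A$ has almost minimal multiplicity, i.e. $e=b+1$, and that its reduction number is $r=3$. Let $xA$ be any minimal reduction of $\mathfrak m$. (1) Let $G(\mathfrak m)=\bigoplus_{n\ge 0}\mathfrak m^n/\mathfrak m^{n+1}$ be the tangent cone, $F(x)=\bigoplus_{n\ge 0}x^nA/x^n\mathfrak m$, acting on $G(\mathfrak m)$ through the map induced by the inclusion $xA\subseteq\mathfrak m$, and let $x^*\in F(x)$ be the class of $x$ in $xA/x\mathfrak m$. There is an isomorphism of graded $F(x)$-modules $$G(\mathfrak m)\cong\bigoplus_{i=0}^{r}\bigl(F(x)(-i)\bigr)^{\alpha_i}\oplus\bigoplus_{i=1}^{r-1}\bigoplus_{j=1}^{r-i}\Bigl(\frac{F(x)}{(x^*)^jF(x)}(-i)\Bigr)^{\alpha_{i,j}}$$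 with non-negative integers $\alpha_i,\alpha_{i,j}$, and in every such decomposition $$(\alpha_1,\alpha_2,\alpha_3)=(e-3,1,1).$$ (2) Let $A'$ be the first neighborhood ring of $A$, i.e. the ring of all elements $c/a$ of the total ring of fractions of $A$ with $c\in\mathfrak m^s$ and $a$ superficial of degree $s$ for some $s\ge 0$ (that is, $a\in\mathfrak m^s$ and $\mathfrak m^{n+s}=a\mathfrak m^n$ for all large $n$). The micro-invariants $$\beta_i=\lambda\Bigl(\frac{A+\mathfrak m^{i-1}A'}{A+\mathfrak m^iA'}\Bigr)-\lambda\Bigl(\frac{A+\mathfrak m^{i}A'}{A+\mathfrak m^{i+1}A'}\Bigr)$$ (in which all lengths are finite) satisfy $(\beta_1,\beta_2,\beta_3)=(e-3,2,0)$. (3) The Apery invariants $\gamma_i=\lambda\bigl((\mathfrak m^i+xA)/(\mathfrak m^{i+1}+xA)\bigr)$ satisfy $(\gamma_1,\gamma_2,\gamma_3)=(e-2,1,0)$. -/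

import Mathlib

open IsLocalRing Polynomial

noncomputable section

/-! ### Lengths, multiplicity, reductions -/

/-- The length `λ(P / Q)` of the quotient of two submodules `Q ≤ P` of an `A`-module. -/
def relLength {A M : Type*} [CommRing A] [AddCommGroup M] [Module A M]
    (P Q : Submodule A M) : ℕ∞ :=
  Module.length A (P ⧸ Q.submoduleOf P)

/-- A Noetherian local ring is Cohen-Macaulay if its maximal ideal contains a regular sequence
whose length is the Krull dimension (the Noetherian hypothesis is carried separately). -/
def IsCohenMacaulayLocal (A : Type*) [CommRing A] [IsLocalRing A] : Prop :=
  ∃ rs : List A, (∀ a ∈ rs, a ∈ maximalIdeal A) ∧ RingTheory.Sequence.IsRegular A rs ∧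
    (rs.length : WithBot ℕ∞) = ringKrullDim A

/-- The Hilbert function `H(n) = λ(𝔪ⁿ / 𝔪ⁿ⁺¹)`. -/
def hilbertFunction (A : Type*) [CommRing A] [IsLocalRing A] (n : ℕ) : ℕ∞ :=
  relLength (maximalIdeal A ^ n) (maximalIdeal A ^ (n + 1))

/-- `e` is the multiplicity of the one-dimensional local ring `A`: for some integer `ρ`, the
Hilbert-Samuel function satisfies `H(0) + ⋯ + H(n) = e (n + 1) - ρ` for all large `n`. -/
def HasMultiplicity (A : Type*) [CommRing A] [IsLocalRing A] (e : ℕ) : Prop :=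
  ∃ ρ : ℤ, ∀ᶠ n : ℕ in Filter.atTop, ∃ h : ℕ,
    ∑ i ∈ Finset.range (n + 1), hilbertFunction A i = (h : ℕ∞) ∧
      (h : ℤ) = (e : ℤ) * ((n : ℤ) + 1) - ρ

/-- The embedding dimension `b = μ(𝔪)`, the least number of generators of the maximal ideal. -/
def embeddingDim (A : Type*) [CommRing A] [IsLocalRing A] : ℕ :=
  (maximalIdeal A).spanFinrank

/-- `A` has almost minimal multiplicity `e`: the multiplicity is `e` and it is one more than the
embedding dimension. -/
def HasAlmostMinimalMultiplicity (A : Type*) [CommRing A] [IsLocalRing A] (e : ℕ) : Prop :=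
  HasMultiplicity A e ∧ e = embeddingDim A + 1

/-- `J` is a reduction of the ideal `I`. -/
def IsIdealReduction {A : Type*} [CommRing A] (I J : Ideal A) : Prop :=
  J ≤ I ∧ ∃ n : ℕ, I ^ (n + 1) = J * I ^ n

/-- `J` is a minimal reduction of `I`: a reduction that contains no smaller one. -/
def IsMinimalReduction {A : Type*} [CommRing A] (I J : Ideal A) : Prop :=
  Minimal (IsIdealReduction I) J

theorem IsMinimalReduction.le {A : Type*} [CommRing A] {I J : Ideal A}
    (h : IsMinimalReduction I J) : J ≤ I :=
  h.prop.1

/-- `A` has reduction number `r`: for a principal minimal reduction `yA` of the maximal ideal,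
`r` is the least integer with `𝔪ʳ⁺¹ = y 𝔪ʳ`. (In a one-dimensional Cohen-Macaulay local ring this
integer is the same for all `y`.) -/
def HasReductionNumber (A : Type*) [CommRing A] [IsLocalRing A] (r : ℕ) : Prop :=
  ∃ y : A, IsMinimalReduction (maximalIdeal A) (Ideal.span {y}) ∧
    IsLeast {n : ℕ | maximalIdeal A ^ (n + 1) = Ideal.span {y} * maximalIdeal A ^ n} r

/-! ### The tangent cone and its invariants -/

/-- The graded ring `⨁ₙ Iⁿ / J Iⁿ`, as the quotient `A[It] / J A[It]` of the Rees algebra. For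
`I = J = 𝔪` it is the tangent cone `G(𝔪) = ⨁ₙ 𝔪ⁿ / 𝔪ⁿ⁺¹`; for `J = 𝔪` and `I = xA` it is
`F(x) = ⨁ₙ xⁿA / xⁿ𝔪`. -/
def FiberRing {A : Type*} [CommRing A] (J I : Ideal A) : Type _ :=
  reesAlgebra I ⧸ J.map (algebraMap A (reesAlgebra I))

instance FiberRing.instCommRing {A : Type*} [CommRing A] (J I : Ideal A) :
    CommRing (FiberRing J I) :=
  inferInstanceAs (CommRing (reesAlgebra I ⧸ J.map (algebraMap A (reesAlgebra I))))

instance FiberRing.instAlgebra {A : Type*} [CommRing A] (J I : Ideal A) :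
    Algebra A (FiberRing J I) :=
  inferInstanceAs (Algebra A (reesAlgebra I ⧸ J.map (algebraMap A (reesAlgebra I))))

/-- The projection `A[It] → ⨁ₙ Iⁿ / J Iⁿ`. -/
def FiberRing.mk {A : Type*} [CommRing A] (J I : Ideal A) : reesAlgebra I →ₐ[A] FiberRing J I :=
  Ideal.Quotient.mkₐ A (J.map (algebraMap A (reesAlgebra I)))

/-- The component `Iⁿ / J Iⁿ` of degree `n`: the classes of the monomials `a tⁿ`, `a ∈ Iⁿ`. -/
def FiberRing.piece {A : Type*} [CommRing A] (J I : Ideal A) (n : ℕ) :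
    Submodule A (FiberRing J I) :=
  ((LinearMap.range (monomial n : A →ₗ[A] A[X])).comap (reesAlgebra I).val.toLinearMap).map
    (FiberRing.mk J I).toLinearMap

/-- The component of degree `n` of the graded module `R(-i)`, where `R = ⨁ₙ Iⁿ / J Iⁿ`. -/
def FiberRing.shiftedPiece {A : Type*} [CommRing A] (J I : Ideal A) (i n : ℕ) :
    Submodule A (FiberRing J I) :=
  if i ≤ n then FiberRing.piece J I (n - i) else ⊥

theorem FiberRing.map_le_comap {A : Type*} [CommRing A] (J : Ideal A) {I I' : Ideal A}
    (h : reesAlgebra I ≤ reesAlgebra I') :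
    J.map (algebraMap A (reesAlgebra I)) ≤
      (J.map (algebraMap A (reesAlgebra I'))).comap (Subalgebra.inclusion h) := by
  rw [Ideal.map_le_iff_le_comap]
  intro a ha
  exact Ideal.mem_map_of_mem (algebraMap A (reesAlgebra I')) ha

theorem reesAlgebra_le_of_le {A : Type*} [CommRing A] {I I' : Ideal A} (h : I ≤ I') :
    reesAlgebra I ≤ reesAlgebra I' :=
  fun _ hf i => Ideal.pow_right_mono h i (hf i)

/-- The homomorphism `⨁ₙ Iⁿ / J Iⁿ → ⨁ₙ I'ⁿ / J I'ⁿ` induced by an inclusion `I ≤ I'`. -/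
def FiberRing.map {A : Type*} [CommRing A] (J : Ideal A) {I I' : Ideal A} (h : I ≤ I') :
    FiberRing J I →ₐ[A] FiberRing J I' :=
  Ideal.quotientMapₐ _ (Subalgebra.inclusion (reesAlgebra_le_of_le h))
    (FiberRing.map_le_comap J (reesAlgebra_le_of_le h))

/-- The tangent cone `G(𝔪) = ⨁ₙ 𝔪ⁿ / 𝔪ⁿ⁺¹`. -/
abbrev TangentCone (A : Type*) [CommRing A] [IsLocalRing A] : Type _ :=
  FiberRing (maximalIdeal A) (maximalIdeal A)

/-- The Noether normalization `F(x) = ⨁ₙ xⁿA / xⁿ𝔪` of the tangent cone. -/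
abbrev NoetherNorm {A : Type*} [CommRing A] [IsLocalRing A] (x : A) : Type _ :=
  FiberRing (maximalIdeal A) (Ideal.span {x})

/-- The class `x* ∈ F(x)` of `x` in `xA / x𝔪`. -/
def initialForm {A : Type*} [CommRing A] [IsLocalRing A] (x : A) : NoetherNorm x :=
  FiberRing.mk _ _ ⟨monomial 1 x, reesAlgebra.monomial_mem.mpr
    (by rw [pow_one]; exact Ideal.mem_span_singleton_self x)⟩

/-- Indices of the free summands: `α i` copies of each degree `0 ≤ i ≤ r`. -/
abbrev FreeIndex (r : ℕ) (α : ℕ → ℕ) : Type :=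
  Σ i : Fin (r + 1), Fin (α i)

/-- Indices of the torsion summands: `τ i j` copies for each pair `1 ≤ i ≤ r - 1`,
`1 ≤ j ≤ r - i`. -/
abbrev TorsionIndex (r : ℕ) (τ : ℕ → ℕ → ℕ) : Type :=
  Σ i : Finset.Icc 1 (r - 1), Σ j : Finset.Icc 1 (r - i), Fin (τ i j)

/-- The `F(x)`-module `⨁_{0≤i≤r} F(x)^{α i} ⊕ ⨁_{1≤i≤r-1} ⨁_{1≤j≤r-i} (F(x)/(x*)ʲ)^{τ i j}`
(its grading is given by the next definition). -/
abbrev DecompModule {A : Type*} [CommRing A] [IsLocalRing A] (x : A) (r : ℕ) (α : ℕ → ℕ)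
    (τ : ℕ → ℕ → ℕ) : Type _ :=
  (FreeIndex r α → NoetherNorm x) ×
    ((q : TorsionIndex r τ) → NoetherNorm x ⧸ Ideal.span {initialForm x ^ (q.2.1 : ℕ)})

/-- `z` is homogeneous of degree `n` in
`⨁ F(x)(-i)^{α i} ⊕ ⨁ (F(x)/(x*)ʲ F(x))(-i)^{τ i j}`. -/
def DecompModule.IsHomogeneousOfDegree {A : Type*} [CommRing A] [IsLocalRing A] {x : A} {r : ℕ}
    {α : ℕ → ℕ} {τ : ℕ → ℕ → ℕ} (n : ℕ) (z : DecompModule x r α τ) : Prop :=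
  (∀ p, z.1 p ∈ FiberRing.shiftedPiece (maximalIdeal A) (Ideal.span {x}) (p.1 : ℕ) n) ∧
  ∀ q, ∃ f ∈ FiberRing.shiftedPiece (maximalIdeal A) (Ideal.span {x}) (q.1 : ℕ) n,
    Ideal.Quotient.mk _ f = z.2 q

/-- `α` and `τ` are the invariants `α_i`, `α_{i,j}` of the tangent cone with respect to `x`: there
is an isomorphism of graded `F(x)`-modules
`⨁_{0≤i≤r} F(x)(-i)^{α i} ⊕ ⨁_{1≤i≤r-1} ⨁_{1≤j≤r-i} (F(x)/(x*)ʲ F(x))(-i)^{τ i j} ≅ G(𝔪)`,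
where `F(x)` acts on `G(𝔪)` through the homomorphism induced by `xA ⊆ 𝔪`. -/
def HasTangentConeInvariants {A : Type*} [CommRing A] [IsLocalRing A] (x : A)
    (hx : Ideal.span {x} ≤ maximalIdeal A) (r : ℕ) (α : ℕ → ℕ) (τ : ℕ → ℕ → ℕ) : Prop :=
  ∃ Φ : DecompModule x r α τ ≃+ TangentCone A,
    (∀ (c : NoetherNorm x) (z : DecompModule x r α τ),
      Φ (c • z) = FiberRing.map (maximalIdeal A) hx c * Φ z) ∧
    ∀ (n : ℕ) (z : DecompModule x r α τ), z.IsHomogeneousOfDegree n →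
      Φ z ∈ FiberRing.piece (maximalIdeal A) (maximalIdeal A) n

/-! ### The first neighborhood ring and the micro-invariants -/

/-- `a` is superficial of degree `s`: `a ∈ 𝔪ˢ` and `𝔪ⁿ⁺ˢ = a 𝔪ⁿ` for all large `n`. -/
def IsSuperficial {A : Type*} [CommRing A] [IsLocalRing A] (s : ℕ) (a : A) : Prop :=
  a ∈ maximalIdeal A ^ s ∧ ∀ᶠ n : ℕ in Filter.atTop,
    maximalIdeal A ^ (n + s) = Ideal.span {a} * maximalIdeal A ^ n

theorem IsSuperficial.one {A : Type*} [CommRing A] [IsLocalRing A] :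
    IsSuperficial 0 (1 : A) :=
  ⟨by simp, by simp⟩

theorem IsSuperficial.mul {A : Type*} [CommRing A] [IsLocalRing A] {s t : ℕ} {a c : A}
    (ha : IsSuperficial s a) (hc : IsSuperficial t c) : IsSuperficial (s + t) (a * c) := by
  refine ⟨by rw [pow_add]; exact Ideal.mul_mem_mul ha.1 hc.1, ?_⟩
  have h := (Filter.tendsto_add_atTop_nat t).eventually ha.2
  filter_upwards [h, hc.2] with n h₁ h₂
  rw [← Ideal.span_singleton_mul_span_singleton, mul_assoc, ← h₂, ← h₁]
  congr 1
  ring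

/-- The first neighborhood ring `A'`: all fractions `b / a` in the total ring of fractions `Q(A)`
with `b ∈ 𝔪ˢ` and `a` a (regular) superficial element of degree `s`. -/
def firstNeighborhoodRing (A : Type*) [CommRing A] [IsLocalRing A] :
    Subalgebra A (FractionRing A) where
  carrier := {z | ∃ (s : ℕ) (a : nonZeroDivisors A) (b : A), IsSuperficial s (a : A) ∧
    b ∈ maximalIdeal A ^ s ∧ z = IsLocalization.mk' (FractionRing A) b a}
  mul_mem' := by
    rintro _ _ ⟨s, a, b, ha, hb, rfl⟩ ⟨t, c, d, hc, hd, rfl⟩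
    refine ⟨s + t, a * c, b * d, ha.mul hc, ?_, (IsLocalization.mk'_mul _ _ _ _ _).symm⟩
    rw [pow_add]
    exact Ideal.mul_mem_mul hb hd
  add_mem' := by
    rintro _ _ ⟨s, a, b, ha, hb, rfl⟩ ⟨t, c, d, hc, hd, rfl⟩
    refine ⟨s + t, a * c, b * c + d * a, ha.mul hc, ?_, (IsLocalization.mk'_add _ _ _ _).symm⟩
    refine Ideal.add_mem _ ?_ ?_
    · rw [pow_add]
      exact Ideal.mul_mem_mul hb hc.1
    · rw [pow_add, mul_comm d]
      exact Ideal.mul_mem_mul ha.1 hd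
  algebraMap_mem' c :=
    ⟨0, 1, c, IsSuperficial.one, by simp, (IsLocalization.mk'_one _ c).symm⟩

/-- The `A`-submodule `A + 𝔪ⁱA'` of `Q(A)`. -/
def neighborhoodFiltration (A : Type*) [CommRing A] [IsLocalRing A] (i : ℕ) :
    Submodule A (FractionRing A) :=
  Subalgebra.toSubmodule ⊥ ⊔
    maximalIdeal A ^ i • Subalgebra.toSubmodule (firstNeighborhoodRing A)

/-- `β` is the micro-invariant `β_i` of `A` (for `i ≥ 1`):
`β_i = λ((A + 𝔪ⁱ⁻¹A') / (A + 𝔪ⁱA')) - λ((A + 𝔪ⁱA') / (A + 𝔪ⁱ⁺¹A'))`, both lengths being finite. -/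
def IsMicroInvariant (A : Type*) [CommRing A] [IsLocalRing A] (i : ℕ) (β : ℤ) : Prop :=
  ∃ p q : ℕ,
    relLength (neighborhoodFiltration A (i - 1)) (neighborhoodFiltration A i) = (p : ℕ∞) ∧
    relLength (neighborhoodFiltration A i) (neighborhoodFiltration A (i + 1)) = (q : ℕ∞) ∧
    β = (p : ℤ) - (q : ℤ)

/-! ### The Apery invariants -/

/-- The Apery invariant `γ_i = λ((𝔪ⁱ + xA) / (𝔪ⁱ⁺¹ + xA))` with respect to `x`. -/
def aperyInvariant {A : Type*} [CommRing A] [IsLocalRing A] (x : A) (i : ℕ) : ℕ∞ :=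
  relLength (maximalIdeal A ^ i ⊔ Ideal.span {x}) (maximalIdeal A ^ (i + 1) ⊔ Ideal.span {x})

end

/-! Write `m` for the maximal ideal and `H` for the Hilbert function. Since `x` is regular, `λ(m^k /
x m^k) = e` for every `k`, so `H(k) + λ(m^(k+1) / x m^k) = e` (`hilbertFunction_add_relLength`).
Thus `m^(k+1) = x m^k` exactly when `H(k) = e`, a condition independent of `x`, and the hypotheses
give `H(0) = 1`, `H(1) = e - 1`, `H(2) ≠ e` and `H(n) = e` for `n ≥ 3`.

The structure of `m` comes from `exists_isAlmostMinimalSystem`. As `λ(m^2 / x m) = 1`, some product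
`w = y z` generates `m^2` modulo `x m`, and `m^3 ⊆ x m`. Then `y w` generates `m^3` modulo `x m^2`,
with `λ(m^3 / x m^2) = 1`, whence `H(2) = e - 1`. Writing `y w = x h`, the element `h` is part of a
minimal generating set of `m` together with `x`, and its initial form is killed by `x*`.

So the tangent cone is generated over `F(x)` by `1`, by `e - 3` forms of degree one, by the torsion
class of `h`, and by the classes of `w` and `y w` in degrees 2 and 3. The resulting surjection from
the decomposition module is bijective because lengths agree in each degree. Conversely, the lengths
of `(x*)^k G_s`, computed on both sides of any decomposition, form a linear system that determines
`α_1, α_2, α_3`.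

For the micro-invariants, `A' = x^(-3) m^3`, so multiplication by `x^3` moves the filtration into
`A`, where `m^5 ⊆ x^3 A` and `λ(A / x^3 A) = 3e` finish the count. The Apery invariants follow from
`m^3 ⊆ xA` and `λ(A / xA) = e`. -/

/-! ### Lengths of quotients of submodules -/

section RelLength

variable {A M N : Type*} [CommRing A] [AddCommGroup M] [Module A M] [AddCommGroup N] [Module A N]

theorem relLength_add_relLength {P Q R : Submodule A M} (hRQ : R ≤ Q) (hQP : Q ≤ P) :
    relLength P Q + relLength Q R = relLength P R := by
  unfold relLength
  rw [add_comm]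
  symm
  have hRP : R.submoduleOf P ≤ Q.submoduleOf P := fun z hz => hRQ hz
  refine Module.length_eq_add_of_exact
    (Submodule.mapQ (R.submoduleOf Q) (R.submoduleOf P) (Submodule.inclusion hQP)
      (show R.submoduleOf Q ≤ (R.submoduleOf P).comap (Submodule.inclusion hQP) from
        fun z hz => hz))
    (Submodule.factor hRP) ?_ (Submodule.factor_surjective hRP) ?_
  · rw [injective_iff_map_eq_zero]
    intro z hz
    obtain ⟨z, rfl⟩ := Submodule.mkQ_surjective _ z
    exact (Submodule.Quotient.mk_eq_zero (R.submoduleOf Q)).2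
      ((Submodule.Quotient.mk_eq_zero (R.submoduleOf P)).1 hz :)
  · intro z
    obtain ⟨z, rfl⟩ := Submodule.mkQ_surjective _ z
    constructor
    · intro h
      have h' : (z : M) ∈ Q := (Submodule.Quotient.mk_eq_zero (Q.submoduleOf P)).1 h
      exact ⟨Submodule.Quotient.mk ⟨z, h'⟩, rfl⟩
    · rintro ⟨w, hw⟩
      obtain ⟨w, rfl⟩ := Submodule.mkQ_surjective _ w
      rw [← hw]
      exact (Submodule.Quotient.mk_eq_zero (Q.submoduleOf P)).2 w.2

theorem relLength_eq_zero_iff {P Q : Submodule A M} : relLength P Q = 0 ↔ P ≤ Q := by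
  unfold relLength
  rw [Module.length_eq_zero_iff, Submodule.Quotient.subsingleton_iff]
  exact Submodule.submoduleOf_eq_top

theorem relLength_map {f : M →ₗ[A] N} (hf : Function.Injective f) (P Q : Submodule A M) :
    relLength (P.map f) (Q.map f) = relLength P Q := by
  refine (LinearEquiv.length_eq (Submodule.Quotient.equiv _ _
    (Submodule.equivMapOfInjective f hf P) ?_)).symm
  ext ⟨z, hz⟩
  obtain ⟨y, hy, rfl⟩ := hz
  constructor
  · rintro ⟨t, ht, h⟩
    exact ⟨t, ht, congrArg Subtype.val h⟩
  · rintro ⟨t, ht, h⟩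
    obtain rfl := hf h
    exact ⟨⟨t, hy⟩, ht, rfl⟩

theorem eq_sup_span_singleton_of_relLength_eq_one {P Q : Submodule A M} (hQP : Q ≤ P)
    (h : relLength P Q = 1) {g : M} (hg : g ∈ P) (hgQ : g ∉ Q) :
    P = Q ⊔ Submodule.span A {g} := by
  have hle : Q ⊔ Submodule.span A {g} ≤ P :=
    sup_le hQP ((Submodule.span_singleton_le_iff_mem _ _).2 hg)
  refine le_antisymm (relLength_eq_zero_iff.1 ?_) hle
  have h1 := relLength_add_relLength (le_sup_left : Q ≤ Q ⊔ Submodule.span A {g}) hle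
  have h2 : 1 ≤ relLength (Q ⊔ Submodule.span A {g}) Q := by
    rw [Order.one_le_iff_ne_zero, Ne, relLength_eq_zero_iff]
    exact fun hc => hgQ (hc (Submodule.mem_sup_right (Submodule.mem_span_singleton_self g)))
  rw [h] at h1
  generalize relLength P (Q ⊔ Submodule.span A {g}) = u at *
  generalize relLength (Q ⊔ Submodule.span A {g}) Q = v at *
  have hu : u ≠ ⊤ := by rintro rfl; simp at h1
  have hv : v ≠ ⊤ := by rintro rfl; simp at h1
  lift u to ℕ using hu
  lift v to ℕ using hv
  norm_cast at *
  omega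

variable [IsLocalRing A]

theorem relLength_sup_span_singleton {Q : Submodule A M} {g : M}
    (hg : ∀ a ∈ maximalIdeal A, a • g ∈ Q) (hgQ : g ∉ Q) :
    relLength (Q ⊔ Submodule.span A {g}) Q = 1 := by
  have hmem : g ∈ Q ⊔ Submodule.span A {g} :=
    Submodule.mem_sup_right (Submodule.mem_span_singleton_self g)
  let f : A →ₗ[A] ↥(Q ⊔ Submodule.span A {g}) ⧸ Q.submoduleOf (Q ⊔ Submodule.span A {g}) :=
    (Q.submoduleOf _).mkQ ∘ₗ LinearMap.toSpanSingleton A _ ⟨g, hmem⟩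
  have hmk : ∀ a, f a = 0 ↔ a • g ∈ Q := fun a =>
    Submodule.Quotient.mk_eq_zero (Q.submoduleOf (Q ⊔ Submodule.span A {g}))
  have hf : Function.Surjective f := by
    intro z
    obtain ⟨⟨z, hz⟩, rfl⟩ := Submodule.mkQ_surjective _ z
    obtain ⟨q, hq, t, ht, rfl⟩ := Submodule.mem_sup.1 hz
    obtain ⟨a, rfl⟩ := Submodule.mem_span_singleton.1 ht
    refine ⟨a, ?_⟩
    refine (Submodule.Quotient.eq (Q.submoduleOf (Q ⊔ Submodule.span A {g}))).2 ?_
    change a • g - (q + a • g) ∈ Q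
    simpa using hq
  have hker : LinearMap.ker f = maximalIdeal A := by
    ext a
    rw [LinearMap.mem_ker, hmk]
    refine ⟨fun h => ?_, hg a⟩
    by_contra ha
    obtain ⟨u, rfl⟩ : IsUnit a := by simpa using ha
    exact hgQ (by simpa using Q.smul_mem (↑u⁻¹ : A) h)
  have h := (f.quotKerEquivOfSurjective hf).length_eq
  rw [hker] at h
  unfold relLength
  rw [← h]
  have : IsSimpleModule A (A ⧸ maximalIdeal A) :=
    isSimpleModule_iff_isCoatom.2 (maximalIdeal.isMaximal A).out
  exact Module.length_eq_one A (A ⧸ maximalIdeal A)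

/-- Nakayama by hand: if `a • p` were outside `Q` it would generate `P` modulo `Q`, so `p = q + c a
p` with `1 - c a` a unit, forcing `p ∈ Q`. -/
theorem smul_mem_of_relLength_eq_one {P Q : Submodule A M} (hQP : Q ≤ P)
    (h : relLength P Q = 1) {a : A} (ha : a ∈ maximalIdeal A) {p : M} (hp : p ∈ P) :
    a • p ∈ Q := by
  by_contra hap
  have hP := eq_sup_span_singleton_of_relLength_eq_one hQP h (P.smul_mem a hp) hap
  rw [hP] at hp
  obtain ⟨q, hq, t, ht, hqt⟩ := Submodule.mem_sup.1 hp
  obtain ⟨c, rfl⟩ := Submodule.mem_span_singleton.1 ht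
  have hu : IsUnit (1 - c * a) :=
    isUnit_one_sub_self_of_mem_nonunits _ (Ideal.mul_mem_left _ c ha)
  obtain ⟨u, hu⟩ := hu
  have hq' : (u : A) • p ∈ Q := by
    rw [hu, sub_smul, one_smul, mul_smul, sub_eq_iff_eq_add.2 hqt.symm]
    exact hq
  exact hap (Q.smul_mem a (by simpa using Q.smul_mem (↑u⁻¹ : A) hq'))

/-- `P / Q` is a vector space over the residue field; the induction enlarges `Q` by one basis vector
at a time. -/
theorem exists_generators_of_relLength_eq {P : Submodule A M} (d : ℕ) :
    ∀ {Q : Submodule A M}, Q ≤ P → (∀ a ∈ maximalIdeal A, ∀ p ∈ P, a • p ∈ Q) →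
      relLength P Q = d → ∃ g : Fin d → M, P = Q ⊔ Submodule.span A (Set.range g) := by
  induction d with
  | zero =>
    intro Q hQP _ h
    refine ⟨Fin.elim0, ?_⟩
    rw [Set.range_eq_empty, Submodule.span_empty, sup_bot_eq]
    exact le_antisymm (relLength_eq_zero_iff.1 (by simpa using h)) hQP
  | succ d ih =>
    intro Q hQP hm h
    obtain ⟨g₀, hg₀, hg₀Q⟩ : ∃ g ∈ P, g ∉ Q := by
      by_contra! hc
      rw [relLength_eq_zero_iff.2 hc] at h
      norm_cast at h
    have hle : Q ⊔ Submodule.span A {g₀} ≤ P :=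
      sup_le hQP ((Submodule.span_singleton_le_iff_mem _ _).2 hg₀)
    have h1 := relLength_add_relLength (le_sup_left : Q ≤ Q ⊔ Submodule.span A {g₀}) hle
    rw [relLength_sup_span_singleton (fun a ha => hm a ha g₀ hg₀) hg₀Q, h, Nat.cast_add,
      Nat.cast_one] at h1
    obtain ⟨g, hg⟩ := ih hle (fun a ha p hp => Submodule.mem_sup_left (hm a ha p hp))
      (WithTop.add_right_cancel ENat.one_ne_top h1)
    refine ⟨Fin.cons g₀ g, ?_⟩
    rw [Fin.range_cons, Submodule.span_insert, ← sup_assoc]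
    exact hg

end RelLength

/-! ### Hilbert function and principal reductions -/

section Hilbert

variable {A : Type*} [CommRing A]

theorem span_singleton_mul_eq_map (x : A) (P : Ideal A) :
    Ideal.span {x} * P = Submodule.map (LinearMap.mulLeft A x) P := by
  ext z
  rw [Ideal.mem_span_singleton_mul]
  rfl

theorem mulLeft_injective_of_mem_nonZeroDivisors {x : A} (hx : x ∈ nonZeroDivisors A) :
    Function.Injective (LinearMap.mulLeft A x) :=
  fun _ _ h => (mul_cancel_left_mem_nonZeroDivisors hx).1 h

theorem relLength_span_singleton_mul {x : A} (hx : x ∈ nonZeroDivisors A) (P Q : Ideal A) :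
    relLength (Ideal.span {x} * P) (Ideal.span {x} * Q) = relLength P Q := by
  rw [span_singleton_mul_eq_map, span_singleton_mul_eq_map]
  exact relLength_map (mulLeft_injective_of_mem_nonZeroDivisors hx) P Q

theorem mul_mem_span_singleton_mul_iff {x : A} (hx : x ∈ nonZeroDivisors A) {P : Ideal A} {a : A} :
    x * a ∈ Ideal.span {x} * P ↔ a ∈ P := by
  rw [Ideal.mem_span_singleton_mul]
  exact ⟨fun ⟨z, hz, h⟩ => (mul_cancel_left_mem_nonZeroDivisors hx).1 h ▸ hz,
    fun h => ⟨a, h, rfl⟩⟩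

theorem pow_succ_eq_span_mul_of_le {I J : Ideal A} {n : ℕ} (h : I ^ (n + 1) = J * I ^ n) {k : ℕ}
    (hk : n ≤ k) : I ^ (k + 1) = J * I ^ k := by
  induction k, hk using Nat.le_induction with
  | base => exact h
  | succ k _ ih => rw [pow_succ, ih, mul_assoc, ← pow_succ, ih]

variable [IsLocalRing A]

theorem hilbertFunction_ne_top {e : ℕ} (he : HasMultiplicity A e) (i : ℕ) :
    hilbertFunction A i ≠ ⊤ := by
  obtain ⟨ρ, h⟩ := he
  obtain ⟨n, hn, k, hk, -⟩ := ((Filter.eventually_ge_atTop i).and h).exists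
  have hle := Finset.single_le_sum (f := fun i => hilbertFunction A i)
    (fun _ _ => zero_le) (Finset.mem_range.2 (Nat.lt_succ_of_le hn))
  rw [hk] at hle
  exact ne_top_of_le_ne_top (ENat.natCast_ne_top k) hle

theorem eventually_hilbertFunction_eq {e : ℕ} (he : HasMultiplicity A e) :
    ∀ᶠ n in Filter.atTop, hilbertFunction A n = e := by
  have hfin := hilbertFunction_ne_top he
  obtain ⟨ρ, h⟩ := he
  have h' := (Filter.tendsto_add_atTop_nat 1).eventually h
  -- Consecutive sums differ by one value of the Hilbert function, and the constant `ρ` cancels.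
  have key : ∀ᶠ n in Filter.atTop, hilbertFunction A (n + 1) = e := by
    filter_upwards [h, h'] with n h1 h2
    obtain ⟨k, hk, hk'⟩ := h1
    obtain ⟨l, hl, hl'⟩ := h2
    rw [Finset.sum_range_succ, hk] at hl
    obtain ⟨t, ht⟩ := ENat.ne_top_iff_exists.1 (hfin (n + 1))
    rw [← ht] at hl ⊢
    norm_cast at hl ⊢
    push_cast at hl'
    have : (l : ℤ) = k + t := by exact_mod_cast hl.symm
    have h3 : (t : ℤ) = e := by linarith
    exact_mod_cast h3
  rw [Filter.eventually_atTop] at key ⊢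
  obtain ⟨N, hN⟩ := key
  refine ⟨N + 1, fun n hn => ?_⟩
  obtain ⟨k, rfl⟩ := Nat.exists_eq_add_of_le hn
  simpa [add_right_comm] using hN (N + k) (by omega)

theorem relLength_pow_ne_top {e : ℕ} (he : HasMultiplicity A e) {k n : ℕ} (hkn : k ≤ n) :
    relLength (maximalIdeal A ^ k) (maximalIdeal A ^ n) ≠ ⊤ := by
  induction n, hkn using Nat.le_induction with
  | base => rw [relLength_eq_zero_iff.2 le_rfl]; exact ENat.zero_ne_top
  | succ n hn ih =>
    rw [← relLength_add_relLength (Ideal.pow_le_pow_right n.le_succ) (Ideal.pow_le_pow_right hn)]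
    exact WithTop.add_ne_top.2 ⟨ih, hilbertFunction_ne_top he n⟩

/-- For large `n`, the length of `m^k / x m^n` is counted along two chains: through `m^n`, where `x
m^n = m^(n+1)` gives `λ(m^k / m^n) + e`, and through `x m^k`, where `λ(x m^k / x m^n) = λ(m^k /
m^n)`. The common finite term cancels. -/
theorem relLength_pow_span_mul {e : ℕ} (he : HasMultiplicity A e) {x : A}
    (hx : x ∈ nonZeroDivisors A) (hr : IsIdealReduction (maximalIdeal A) (Ideal.span {x}))
    (k : ℕ) : relLength (maximalIdeal A ^ k) (Ideal.span {x} * maximalIdeal A ^ k) = e := by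
  obtain ⟨-, N, hN⟩ := hr
  obtain ⟨n, hn, hnN, hnk⟩ := ((eventually_hilbertFunction_eq he).and
    ((Filter.eventually_ge_atTop N).and (Filter.eventually_ge_atTop k))).exists
  have hfin := relLength_pow_ne_top he hnk
  rw [hilbertFunction, pow_succ_eq_span_mul_of_le hN hnN] at hn
  have h1 := relLength_add_relLength
    (Ideal.mul_le_right : Ideal.span {x} * maximalIdeal A ^ n ≤ maximalIdeal A ^ n)
    (Ideal.pow_le_pow_right hnk)
  have h2 := relLength_add_relLength
    (Ideal.mul_mono_right (I := Ideal.span {x}) (Ideal.pow_le_pow_right (I := maximalIdeal A) hnk))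
    (Ideal.mul_le_right : Ideal.span {x} * maximalIdeal A ^ k ≤ maximalIdeal A ^ k)
  rw [relLength_span_singleton_mul hx] at h2
  rw [hn, ← h2, add_comm] at h1
  exact (WithTop.add_right_cancel hfin h1).symm

theorem hilbertFunction_add_relLength {e : ℕ} (he : HasMultiplicity A e) {x : A}
    (hx : x ∈ nonZeroDivisors A) (hr : IsIdealReduction (maximalIdeal A) (Ideal.span {x}))
    (k : ℕ) : hilbertFunction A k +
      relLength (maximalIdeal A ^ (k + 1)) (Ideal.span {x} * maximalIdeal A ^ k) = e := by
  rw [hilbertFunction, relLength_add_relLength _ (Ideal.pow_le_pow_right k.le_succ),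
    relLength_pow_span_mul he hx hr]
  rw [pow_succ']
  exact Ideal.mul_mono_left hr.1

/-- The right-hand side does not involve `x`, so information about one reduction, such as the one
defining the reduction number, transfers to every other. -/
theorem pow_succ_eq_span_mul_iff {e : ℕ} (he : HasMultiplicity A e) {x : A}
    (hx : x ∈ nonZeroDivisors A) (hr : IsIdealReduction (maximalIdeal A) (Ideal.span {x}))
    (k : ℕ) : maximalIdeal A ^ (k + 1) = Ideal.span {x} * maximalIdeal A ^ k ↔
      hilbertFunction A k = e := by
  have h := hilbertFunction_add_relLength he hx hr k
  have hle : Ideal.span {x} * maximalIdeal A ^ k ≤ maximalIdeal A ^ (k + 1) := by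
    rw [pow_succ']
    exact Ideal.mul_mono_left hr.1
  constructor
  · intro heq
    rwa [relLength_eq_zero_iff.2 heq.le, add_zero] at h
  · intro heq
    rw [heq] at h
    exact le_antisymm (relLength_eq_zero_iff.1
      (WithTop.add_left_cancel (ENat.natCast_ne_top e) (h.trans (add_zero _).symm))) hle

/-- A regular `a ∈ m` exists by the Cohen-Macaulay property, and `a^(n+1) ∈ x m^n` is a regular
multiple of `x`; a factor of a regular element is regular. -/
theorem mem_nonZeroDivisors_of_isIdealReduction (hdim : ringKrullDim A = 1)
    (hCM : IsCohenMacaulayLocal A) {x : A}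
    (hr : IsIdealReduction (maximalIdeal A) (Ideal.span {x})) : x ∈ nonZeroDivisors A := by
  obtain ⟨rs, hrs, hreg, hlen⟩ := hCM
  rw [hdim] at hlen
  obtain ⟨a, rfl⟩ := List.length_eq_one_iff.1 (show rs.length = 1 by exact_mod_cast hlen)
  have ha : a ∈ nonZeroDivisors A := by
    have h := ((RingTheory.Sequence.isRegular_cons_iff A a []).1 hreg).1
    rw [mem_nonZeroDivisors_iff_right]
    intro z hz
    exact h (by simpa [mul_comm] using hz)
  obtain ⟨-, n, hn⟩ := hr
  have hmem : a ^ (n + 1) ∈ maximalIdeal A ^ (n + 1) :=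
    Ideal.pow_mem_pow (hrs a (by simp)) _
  rw [hn, Ideal.mem_span_singleton_mul] at hmem
  obtain ⟨z, -, hz⟩ := hmem
  have h := pow_mem ha (n + 1)
  rw [← hz] at h
  exact (mul_mem_nonZeroDivisors.1 h).1

theorem hilbertFunction_eq_of_hasReductionNumber (hdim : ringKrullDim A = 1)
    (hCM : IsCohenMacaulayLocal A) {e r : ℕ} (he : HasMultiplicity A e)
    (hr : HasReductionNumber A r) :
    (∀ k, r ≤ k → hilbertFunction A k = e) ∧ ∀ k < r, hilbertFunction A k ≠ e := by
  obtain ⟨y, hy, hmem, hle⟩ := hr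
  have hy' := mem_nonZeroDivisors_of_isIdealReduction hdim hCM hy.prop
  refine ⟨fun k hk => ?_, fun k hk h => ?_⟩
  · rw [← pow_succ_eq_span_mul_iff he hy' hy.prop]
    exact pow_succ_eq_span_mul_of_le hmem hk
  · rw [← pow_succ_eq_span_mul_iff he hy' hy.prop] at h
    exact absurd (hle h) (by omega)

theorem hilbertFunction_zero : hilbertFunction A 0 = 1 := by
  have h := relLength_sup_span_singleton (A := A) (M := A) (Q := maximalIdeal A) (g := 1)
    (by simp) (fun h => (Ideal.ne_top_iff_one _).1 (maximalIdeal.isMaximal A).ne_top h)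
  rw [hilbertFunction, pow_zero, zero_add, pow_one]
  convert h
  rw [eq_comm, Ideal.one_eq_top]
  refine (Ideal.eq_top_iff_one _).2 (Submodule.mem_sup_right (Submodule.mem_span_singleton_self 1))

theorem hilbertFunction_one [IsNoetherianRing A] : hilbertFunction A 1 = embeddingDim A := by
  rw [embeddingDim, spanFinrank_maximalIdeal_eq_finrank_cotangentSpace,
    ← Module.length_eq_finrank,
    ← Module.length_eq_of_surjective (S := A) (R := ResidueField A) (M := CotangentSpace A)
      (IsLocalRing.residue_surjective)]
  rw [hilbertFunction, relLength, one_add_one_eq_two]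
  refine LinearEquiv.length_eq ?_
  refine Submodule.Quotient.equiv _ _ (LinearEquiv.ofEq _ _ (pow_one _)) ?_
  ext z
  rw [Submodule.mem_smul_top_iff, smul_eq_mul, ← pow_two]
  constructor
  · rintro ⟨t, ht, rfl⟩
    exact ht
  · intro hz
    exact ⟨⟨z, by rw [pow_one]; exact z.2⟩, hz, rfl⟩

/-- Otherwise `m^(N+n) = x^n m^N ⊆ m^(N+n+1)`, so `m^(N+n) = 0` by Nakayama, although it contains
the regular element `x^(N+n)`. -/
theorem pow_notMem_maximalIdeal_pow_succ {x : A} (hx : x ∈ nonZeroDivisors A)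
    [IsNoetherianRing A]
    (hr : IsIdealReduction (maximalIdeal A) (Ideal.span {x})) (n : ℕ) :
    x ^ n ∉ maximalIdeal A ^ (n + 1) := by
  intro hmem
  obtain ⟨hle, N, hN⟩ := hr
  have hpow : ∀ k, maximalIdeal A ^ (N + k) = Ideal.span {x ^ k} * maximalIdeal A ^ N := by
    intro k
    induction k with
    | zero => simp
    | succ k ih =>
      rw [← add_assoc, pow_succ_eq_span_mul_of_le hN (Nat.le_add_right N k), ih, ← mul_assoc,
        Ideal.span_singleton_mul_span_singleton, pow_succ']
  have hzero : maximalIdeal A ^ (N + n) = ⊥ := by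
    refine Submodule.eq_bot_of_le_smul_of_le_jacobson_bot (maximalIdeal A) _
      (IsNoetherian.noetherian _) ?_ (IsLocalRing.maximalIdeal_le_jacobson _)
    rw [smul_eq_mul, ← pow_succ', hpow n, add_assoc, add_comm, pow_add]
    exact Ideal.mul_mono_left ((Ideal.span_singleton_le_iff_mem _).2 hmem)
  have h0 : x ^ (N + n) ∈ maximalIdeal A ^ (N + n) :=
    Ideal.pow_mem_pow (hle (Ideal.mem_span_singleton_self x)) _
  rw [hzero, Ideal.mem_bot] at h0
  exact zero_notMem_nonZeroDivisors (h0 ▸ pow_mem hx (N + n))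

end Hilbert

/-! ### Structure of the maximal ideal; Apery and micro-invariants -/

section AlmostMinimal

theorem ENat.ne_top_of_add_eq_natCast {a b : ℕ∞} {n : ℕ} (h : a + b = n) : a ≠ ⊤ ∧ b ≠ ⊤ :=
  WithTop.add_ne_top.1 (h ▸ ENat.natCast_ne_top n)

variable {A : Type*} [CommRing A] [IsLocalRing A]

/-- Generators modulo `xA` of the powers of the maximal ideal of a one-dimensional Cohen-Macaulay
local ring of almost minimal multiplicity and reduction number `3`, with `xA` a reduction of `𝔪`:
`𝔪² = x𝔪 + wA`, `𝔪³ = x𝔪² + ywA` with `yw = xh`, and `𝔪⁴ = x𝔪³`. -/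
structure IsAlmostMinimalSystem (x y w h : A) : Prop where
  nonZeroDivisors : x ∈ nonZeroDivisors A
  reduction : IsIdealReduction (maximalIdeal A) (Ideal.span {x})
  h_mem : h ∈ maximalIdeal A
  h_notMem : h ∉ Ideal.span {x} ⊔ maximalIdeal A ^ 2
  mul_h : x * h = y * w
  sq_eq : maximalIdeal A ^ 2 = Ideal.span {x} * maximalIdeal A ⊔ Ideal.span {w}
  cube_eq : maximalIdeal A ^ 3 = Ideal.span {x} * maximalIdeal A ^ 2 ⊔ Ideal.span {y * w}
  cube_le : maximalIdeal A ^ 3 ≤ Ideal.span {x} * maximalIdeal A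
  pow_four : maximalIdeal A ^ 4 = Ideal.span {x} * maximalIdeal A ^ 3
  relLength_sq : relLength (maximalIdeal A ^ 2) (Ideal.span {x} * maximalIdeal A) = 1

/-- The generator `w` of `m^2` modulo `x m` is taken to be a product `y z`, so that in `u w = y (z
u)` the factor `z u` can again be reduced modulo `x m`. This makes the single element `y w` generate
`m^3` modulo `x m^2`. -/
theorem exists_isAlmostMinimalSystem [IsNoetherianRing A] {e : ℕ} (he : HasMultiplicity A e)
    (h1 : hilbertFunction A 1 + 1 = e) (h2 : hilbertFunction A 2 ≠ e)
    (h3 : hilbertFunction A 3 = e) {x : A} (hx : x ∈ nonZeroDivisors A)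
    (hr : IsIdealReduction (maximalIdeal A) (Ideal.span {x})) :
    (∃ y w h : A, IsAlmostMinimalSystem x y w h) ∧ hilbertFunction A 2 + 1 = e := by
  have hxm : x ∈ maximalIdeal A := hr.1 (Ideal.mem_span_singleton_self x)
  have hle : ∀ k, Ideal.span {x} * maximalIdeal A ^ k ≤ maximalIdeal A ^ (k + 1) := fun k => by
    rw [pow_succ']
    exact Ideal.mul_mono_left hr.1
  have hle1 : Ideal.span {x} * maximalIdeal A ≤ maximalIdeal A ^ 2 := by
    simpa using hle 1
  have hlen : relLength (maximalIdeal A ^ 2) (Ideal.span {x} * maximalIdeal A) = 1 := by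
    have h := hilbertFunction_add_relLength he hx hr 1
    rw [← h1, pow_one] at h
    exact WithTop.add_left_cancel (hilbertFunction_ne_top he 1) h
  have hcube : maximalIdeal A ^ 3 ≤ Ideal.span {x} * maximalIdeal A := by
    rw [pow_succ' _ 2, Ideal.mul_le]
    exact fun a ha p hp => smul_mem_of_relLength_eq_one hle1 hlen ha hp
  have hnot : ¬ maximalIdeal A ^ 3 ≤ Ideal.span {x} * maximalIdeal A ^ 2 := fun h =>
    h2 ((pow_succ_eq_span_mul_iff he hx hr 2).1 (le_antisymm h (hle 2)))
  obtain ⟨y, hy, z, hz, hyz⟩ : ∃ y ∈ maximalIdeal A, ∃ z ∈ maximalIdeal A,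
      y * z ∉ Ideal.span {x} * maximalIdeal A := by
    by_contra! hc
    rw [relLength_eq_zero_iff.2 (by rw [pow_two, Ideal.mul_le]; exact hc)] at hlen
    exact zero_ne_one hlen
  have hw2 : y * z ∈ maximalIdeal A ^ 2 := by
    rw [pow_two]
    exact Ideal.mul_mem_mul hy hz
  have hsq : maximalIdeal A ^ 2 = Ideal.span {x} * maximalIdeal A ⊔ Ideal.span {y * z} :=
    eq_sup_span_singleton_of_relLength_eq_one hle1 hlen hw2 hyz
  have hw3 : y * (y * z) ∈ maximalIdeal A ^ 3 := by
    rw [pow_succ']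
    exact Ideal.mul_mem_mul hy hw2
  have hcube_eq : maximalIdeal A ^ 3 =
      Ideal.span {x} * maximalIdeal A ^ 2 ⊔ Ideal.span {y * (y * z)} := by
    refine le_antisymm ?_ (sup_le (hle 2) ((Ideal.span_singleton_le_iff_mem _).2 hw3))
    rw [pow_succ' _ 2, Ideal.mul_le]
    intro u hu v hv
    rw [hsq] at hv
    obtain ⟨s, hs, t, ht, rfl⟩ := Submodule.mem_sup.1 hv
    obtain ⟨s, hs', rfl⟩ := Ideal.mem_span_singleton_mul.1 hs
    obtain ⟨c, rfl⟩ := Ideal.mem_span_singleton'.1 ht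
    -- Write `z u = x p + d w`; then `u w = x (y p) + d (y w)` with `y p ∈ m^2`.
    have huz : z * u ∈ maximalIdeal A ^ 2 := by
      rw [pow_two]
      exact Ideal.mul_mem_mul hz hu
    rw [hsq] at huz
    obtain ⟨p, hp, q, hq, hpq⟩ := Submodule.mem_sup.1 huz
    obtain ⟨p, hp', rfl⟩ := Ideal.mem_span_singleton_mul.1 hp
    obtain ⟨d, rfl⟩ := Ideal.mem_span_singleton'.1 hq
    have hrw : u * (x * s + c * (y * z)) = x * (u * s + c * (y * p)) + c * d * (y * (y * z)) := by
      linear_combination (-(c * y)) * hpq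
    rw [hrw]
    refine add_mem (Submodule.mem_sup_left (Ideal.mem_span_singleton_mul.2 ⟨_, ?_, rfl⟩))
      (Submodule.mem_sup_right (Ideal.mem_span_singleton'.2 ⟨c * d, rfl⟩))
    rw [pow_two]
    exact add_mem (Ideal.mul_mem_mul hu hs') (Ideal.mul_mem_left _ c (Ideal.mul_mem_mul hy hp'))
  have hyw : y * (y * z) ∉ Ideal.span {x} * maximalIdeal A ^ 2 := fun hc => hnot <| by
    rw [hcube_eq]
    exact sup_le le_rfl ((Ideal.span_singleton_le_iff_mem _).2 hc)
  have hlen2 : relLength (maximalIdeal A ^ 3) (Ideal.span {x} * maximalIdeal A ^ 2) = 1 := by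
    nth_rewrite 1 [hcube_eq]
    refine relLength_sup_span_singleton (fun a ha => ?_) hyw
    -- Since `a w = x p` with `p ∈ m`, the product `a (y w) = x (y p)` lies in `x m^2`.
    have ha' := smul_mem_of_relLength_eq_one hle1 hlen ha hw2
    obtain ⟨p, hp, hpe⟩ := Ideal.mem_span_singleton_mul.1 ha'
    rw [smul_eq_mul] at hpe ⊢
    refine Ideal.mem_span_singleton_mul.2 ⟨y * p, ?_, by linear_combination y * hpe⟩
    rw [pow_two]
    exact Ideal.mul_mem_mul hy hp
  obtain ⟨h, hh, hxh⟩ := Ideal.mem_span_singleton_mul.1 (hcube hw3)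
  have hhnot : h ∉ maximalIdeal A ^ 2 := fun hc =>
    hyw (Ideal.mem_span_singleton_mul.2 ⟨h, hc, hxh⟩)
  refine ⟨⟨y, y * z, h, hx, hr, hh, fun hc => ?_, hxh, hsq, hcube_eq, hcube,
    (pow_succ_eq_span_mul_iff he hx hr 3).2 h3, hlen⟩, ?_⟩
  -- If `h = a x + b` with `b ∈ m^2`, then `x h ∈ m^3` gives `a x^2 ∈ m^3`. As `x^2 ∉ m^3`, `a` is
  -- not a unit, so `h ∈ m^2`, which would put `y w = x h` in `x m^2`.
  · obtain ⟨s, hs, b, hb, rfl⟩ := Submodule.mem_sup.1 hc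
    obtain ⟨a, rfl⟩ := Ideal.mem_span_singleton'.1 hs
    have hxb : x * b ∈ maximalIdeal A ^ 3 := hle 2 (Ideal.mul_mem_mul
      (Ideal.mem_span_singleton_self x) hb)
    have hxa : a * x ^ 2 ∈ maximalIdeal A ^ 3 := by
      rw [← hxh] at hw3
      convert sub_mem hw3 hxb using 1
      ring
    have ha : a ∈ maximalIdeal A := by
      by_contra hu
      obtain ⟨u, rfl⟩ : IsUnit a := by simpa using hu
      exact pow_notMem_maximalIdeal_pow_succ hx hr 2
        (by simpa using Ideal.mul_mem_left _ (↑u⁻¹ : A) hxa)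
    refine hhnot (add_mem ?_ hb)
    rw [pow_two]
    exact Ideal.mul_mem_mul ha hxm
  · rw [← hilbertFunction_add_relLength he hx hr 2, hlen2]

theorem IsAlmostMinimalSystem.x_mem {x y w h : A} (S : IsAlmostMinimalSystem x y w h) :
    x ∈ maximalIdeal A :=
  S.reduction.1 (Ideal.mem_span_singleton_self x)

theorem IsAlmostMinimalSystem.pow_succ_eq {x y w h : A} (S : IsAlmostMinimalSystem x y w h)
    {n : ℕ} (hn : 3 ≤ n) : maximalIdeal A ^ (n + 1) = Ideal.span {x} * maximalIdeal A ^ n :=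
  pow_succ_eq_span_mul_of_le S.pow_four hn

theorem relLength_pow_sup_span_pow [IsNoetherianRing A] {x : A} (hx : x ∈ nonZeroDivisors A)
    (hr : IsIdealReduction (maximalIdeal A) (Ideal.span {x})) (n : ℕ) :
    relLength (maximalIdeal A ^ (n + 1) ⊔ Ideal.span {x ^ n}) (maximalIdeal A ^ (n + 1)) = 1 := by
  refine relLength_sup_span_singleton (fun a ha => ?_) (pow_notMem_maximalIdeal_pow_succ hx hr n)
  rw [pow_succ']
  exact Ideal.mul_mem_mul ha (Ideal.pow_mem_pow (hr.1 (Ideal.mem_span_singleton_self x)) n)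

theorem aperyInvariant_of_isAlmostMinimalSystem [IsNoetherianRing A] {e : ℕ}
    (he : HasMultiplicity A e) (h1 : hilbertFunction A 1 + 1 = e) {x y w h : A}
    (S : IsAlmostMinimalSystem x y w h) :
    aperyInvariant x 1 + 2 = (e : ℕ∞) ∧ aperyInvariant x 2 = 1 ∧ aperyInvariant x 3 = 0 := by
  have hxm : Ideal.span {x} ≤ maximalIdeal A := S.reduction.1
  have hsup : ∀ n, 3 ≤ n → maximalIdeal A ^ n ⊔ Ideal.span {x} = Ideal.span {x} := fun n hn =>
    sup_eq_right.2 ((Ideal.pow_le_pow_right hn).trans (S.cube_le.trans Ideal.mul_le_left))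
  have hm : maximalIdeal A ^ 1 ⊔ Ideal.span {x} = maximalIdeal A := by
    rw [pow_one]
    exact sup_eq_left.2 hxm
  have hle : maximalIdeal A ^ 2 ⊔ Ideal.span {x} ≤ maximalIdeal A :=
    sup_le (Ideal.pow_le_self two_ne_zero) hxm
  -- Passing from `m^2` to `m^2 + xA` uses up one dimension of `m / m^2`.
  have e1 : aperyInvariant x 1 + 1 = hilbertFunction A 1 := by
    rw [aperyInvariant, hm, hilbertFunction, pow_one,
      ← relLength_add_relLength (le_sup_left : _ ≤ maximalIdeal A ^ 2 ⊔ Ideal.span {x}) hle]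
    have h := relLength_pow_sup_span_pow S.nonZeroDivisors S.reduction 1
    rw [pow_one x] at h
    rw [one_add_one_eq_two] at h ⊢
    rw [h]
  -- This is `λ(A / xA) = e` along `A ⊇ m ⊇ m^2 + xA ⊇ xA`, the last step using `m^3 ⊆ xA`.
  have e2 : 1 + (aperyInvariant x 1 + aperyInvariant x 2) = e := by
    rw [aperyInvariant, aperyInvariant, hm, hsup 3 le_rfl,
      relLength_add_relLength le_sup_right hle, ← hilbertFunction_zero (A := A), hilbertFunction,
      zero_add, pow_one, relLength_add_relLength hxm (by simp),
      ← relLength_pow_span_mul he S.nonZeroDivisors S.reduction 0]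
    simp
  have e3 : aperyInvariant x 1 + 2 = (e : ℕ∞) := by
    rw [← h1, ← e1, add_assoc, one_add_one_eq_two]
  refine ⟨e3, ?_, ?_⟩
  · have hfin := (ENat.ne_top_of_add_eq_natCast e3).1
    rw [← e3, ← add_assoc, add_comm 1, add_assoc] at e2
    have h2 := WithTop.add_left_cancel hfin e2
    rw [← one_add_one_eq_two] at h2
    exact WithTop.add_left_cancel ENat.one_ne_top h2
  · rw [aperyInvariant, hsup 3 le_rfl, hsup 4 (by omega), relLength_eq_zero_iff]

/-- This says `A' = x^(-r) m^r`. For a fraction `b / a` with `a` superficial of degree `s`, and `k`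
large, `b x^(r+k)` lies in `m^(r+k+s) = a m^(r+k) = a x^k m^r`; cancelling `x^k` turns the
denominator into `x^r`. -/
theorem mem_firstNeighborhoodRing_iff {r : ℕ} {x : A} (hx : x ∈ nonZeroDivisors A)
    (hr : IsIdealReduction (maximalIdeal A) (Ideal.span {x}))
    (hpow : maximalIdeal A ^ (r + 1) = Ideal.span {x} * maximalIdeal A ^ r)
    (z : FractionRing A) : z ∈ firstNeighborhoodRing A ↔
      ∃ c ∈ maximalIdeal A ^ r, algebraMap A (FractionRing A) (x ^ r) * z = algebraMap A _ c := by
  have hpow' : ∀ k n, r ≤ n →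
      maximalIdeal A ^ (n + k) = Ideal.span {x ^ k} * maximalIdeal A ^ n := by
    intro k n hn
    induction k with
    | zero => simp
    | succ k ih =>
      rw [← add_assoc, pow_succ_eq_span_mul_of_le hpow (hn.trans (Nat.le_add_right n k)), ih,
        ← mul_assoc, Ideal.span_singleton_mul_span_singleton, pow_succ']
  have hxm : x ∈ maximalIdeal A := hr.1 (Ideal.mem_span_singleton_self x)
  constructor
  · rintro ⟨s, a, b, ⟨-, ha⟩, hb, rfl⟩
    obtain ⟨n, hn, hnr⟩ := (ha.and (Filter.eventually_ge_atTop r)).exists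
    obtain ⟨k, rfl⟩ := Nat.exists_eq_add_of_le hnr
    have hmem : b * x ^ (r + k) ∈ maximalIdeal A ^ (r + k + s) := by
      rw [add_comm _ s, pow_add _ s]
      exact Ideal.mul_mem_mul hb (Ideal.pow_mem_pow hxm _)
    rw [hn, hpow' k r le_rfl] at hmem
    obtain ⟨u, hu, hu'⟩ := Ideal.mem_span_singleton_mul.1 hmem
    obtain ⟨c, hc, rfl⟩ := Ideal.mem_span_singleton_mul.1 hu
    refine ⟨c, hc, ?_⟩
    have hca : x ^ r * b = c * a := by
      rw [← mul_cancel_left_mem_nonZeroDivisors (pow_mem hx k)]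
      linear_combination -hu'
    rw [← IsLocalization.mk'_one (M := nonZeroDivisors A) (FractionRing A) (x ^ r),
      ← IsLocalization.mk'_mul, one_mul, hca, IsLocalization.mk'_eq_iff_eq_mul, map_mul]
  · rintro ⟨c, hc, hcz⟩
    refine ⟨r, ⟨x ^ r, pow_mem hx r⟩, c, ⟨Ideal.pow_mem_pow hxm r, ?_⟩, hc, ?_⟩
    · filter_upwards [Filter.eventually_ge_atTop r] with n hn
      exact hpow' r n hn
    · rw [IsLocalization.eq_mk'_iff_mul_eq, ← hcz, mul_comm]

/-- Multiplication by the unit `x^r` of the total ring of fractions carries `A + m^i A'` onto the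
ideal `m^(i+r) + x^r A`. -/
theorem relLength_neighborhoodFiltration {r : ℕ} {x : A} (hx : x ∈ nonZeroDivisors A)
    (hr : IsIdealReduction (maximalIdeal A) (Ideal.span {x}))
    (hpow : maximalIdeal A ^ (r + 1) = Ideal.span {x} * maximalIdeal A ^ r) (i j : ℕ) :
    relLength (neighborhoodFiltration A i) (neighborhoodFiltration A j) =
      relLength (maximalIdeal A ^ (i + r) ⊔ Ideal.span {x ^ r})
        (maximalIdeal A ^ (j + r) ⊔ Ideal.span {x ^ r}) := by
  set u : FractionRing A := algebraMap A (FractionRing A) (x ^ r)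
  have hunit : IsUnit u := IsLocalization.map_units _ (⟨x ^ r, pow_mem hx r⟩ : nonZeroDivisors A)
  have hinj : Function.Injective (LinearMap.mulLeft A u) := fun _ _ h => hunit.mul_left_cancel h
  have hinj' : Function.Injective (Algebra.linearMap A (FractionRing A)) :=
    IsFractionRing.injective A (FractionRing A)
  have hmap : ∀ k, (neighborhoodFiltration A k).map (LinearMap.mulLeft A u) =
      Submodule.map (Algebra.linearMap A (FractionRing A))
        (maximalIdeal A ^ (k + r) ⊔ Ideal.span {x ^ r}) := by
    intro k
    have h1 : (Subalgebra.toSubmodule (⊥ : Subalgebra A (FractionRing A))).map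
        (LinearMap.mulLeft A u) =
        Submodule.map (Algebra.linearMap A (FractionRing A)) (Ideal.span {x ^ r}) := by
      ext z
      simp only [Submodule.mem_map, Subalgebra.mem_toSubmodule, Algebra.mem_bot, Set.mem_range,
        Ideal.mem_span_singleton', LinearMap.mulLeft_apply, Algebra.linearMap_apply]
      constructor
      · rintro ⟨_, ⟨a, rfl⟩, rfl⟩
        exact ⟨_, ⟨a, rfl⟩, by rw [map_mul, mul_comm]⟩
      · rintro ⟨_, ⟨a, rfl⟩, rfl⟩
        exact ⟨_, ⟨a, rfl⟩, by rw [map_mul, mul_comm]⟩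
    have h2 : (Subalgebra.toSubmodule (firstNeighborhoodRing A)).map (LinearMap.mulLeft A u) =
        Submodule.map (Algebra.linearMap A (FractionRing A)) (maximalIdeal A ^ r) := by
      ext z
      simp only [Submodule.mem_map, Subalgebra.mem_toSubmodule, LinearMap.mulLeft_apply,
        Algebra.linearMap_apply]
      constructor
      · rintro ⟨t, ht, rfl⟩
        obtain ⟨c, hc, hct⟩ := (mem_firstNeighborhoodRing_iff hx hr hpow t).1 ht
        exact ⟨c, hc, hct.symm⟩
      · rintro ⟨c, hc, rfl⟩
        obtain ⟨v, hv⟩ := hunit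
        have hvc : u * (↑v⁻¹ * algebraMap A (FractionRing A) c) = algebraMap A _ c := by
          rw [← hv, Units.mul_inv_cancel_left]
        exact ⟨_, (mem_firstNeighborhoodRing_iff hx hr hpow _).2 ⟨c, hc, hvc⟩, hvc⟩
    rw [neighborhoodFiltration, Submodule.map_sup, h1, Submodule.map_smul'', h2,
      ← Submodule.map_smul'', smul_eq_mul, ← pow_add, ← Submodule.map_sup, sup_comm]
  rw [← relLength_map hinj, hmap, hmap, relLength_map hinj']

theorem microInvariant_of_isAlmostMinimalSystem [IsNoetherianRing A] {e : ℕ}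
    (he : HasMultiplicity A e) (h1 : hilbertFunction A 1 + 1 = e)
    (h2 : hilbertFunction A 2 + 1 = e) (h3 : hilbertFunction A 3 = e) {x y w h : A}
    (S : IsAlmostMinimalSystem x y w h) :
    IsMicroInvariant A 1 ((e : ℤ) - 3) ∧ IsMicroInvariant A 2 2 ∧ IsMicroInvariant A 3 0 := by
  have hx := S.nonZeroDivisors
  have key := relLength_neighborhoodFiltration hx S.reduction S.pow_four
  have hx3 : Ideal.span {x ^ 3} ≤ maximalIdeal A ^ 3 :=
    (Ideal.span_singleton_le_iff_mem _).2 (Ideal.pow_mem_pow S.x_mem 3)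
  have hsup0 : maximalIdeal A ^ (0 + 3) ⊔ Ideal.span {x ^ 3} = maximalIdeal A ^ 3 :=
    sup_eq_left.2 hx3
  -- `m^5 = x m^4 = x^2 m^3 ⊆ x^3 m`, so the filtration reaches `A` at index 2.
  have hsup : ∀ n, maximalIdeal A ^ (n + 2 + 3) ⊔ Ideal.span {x ^ 3} = Ideal.span {x ^ 3} := by
    intro n
    refine sup_eq_right.2 ((Ideal.pow_le_pow_right (show 5 ≤ n + 2 + 3 by omega)).trans ?_)
    rw [S.pow_succ_eq (by omega : 3 ≤ 4), S.pow_four, ← mul_assoc]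
    refine (Ideal.mul_mono_right S.cube_le).trans ?_
    rw [← mul_assoc, Ideal.span_singleton_mul_span_singleton,
      Ideal.span_singleton_mul_span_singleton, ← pow_two, ← pow_succ]
    exact Ideal.mul_le_left
  have hle1 : maximalIdeal A ^ 4 ⊔ Ideal.span {x ^ 3} ≤ maximalIdeal A ^ 3 :=
    sup_le (Ideal.pow_le_pow_right (by omega)) hx3
  have e1 : relLength (maximalIdeal A ^ 3) (maximalIdeal A ^ 4 ⊔ Ideal.span {x ^ 3}) + 1 = e := by
    rw [← h3, ← relLength_pow_sup_span_pow hx S.reduction 3]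
    exact relLength_add_relLength le_sup_left hle1
  -- Both sides are `λ(A / x^3 A)`: on the left along the powers of `m` and then `m^4 + x^3 A`, on
  -- the right along the powers of `x`. It forces the last term to be `3e - 1 - 3(e - 1) = 2`.
  have e2 : hilbertFunction A 0 + (hilbertFunction A 1 + (hilbertFunction A 2 +
      (relLength (maximalIdeal A ^ 3) (maximalIdeal A ^ 4 ⊔ Ideal.span {x ^ 3}) +
        relLength (maximalIdeal A ^ 4 ⊔ Ideal.span {x ^ 3}) (Ideal.span {x ^ 3})))) =
      (e : ℕ∞) + (e + e) := by
    have hx1 : ∀ k, relLength (Ideal.span {x ^ k}) (Ideal.span {x ^ (k + 1)}) = e := by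
      intro k
      have h := relLength_span_singleton_mul (pow_mem hx k) (maximalIdeal A ^ 0)
        (Ideal.span {x} * maximalIdeal A ^ 0)
      rwa [relLength_pow_span_mul he hx S.reduction 0, pow_zero, mul_one, mul_one,
        Ideal.span_singleton_mul_span_singleton, ← pow_succ] at h
    have hmono : ∀ k, Ideal.span {x ^ (k + 1)} ≤ Ideal.span {x ^ k} := fun k =>
      Ideal.span_singleton_le_span_singleton.2 (pow_dvd_pow x k.le_succ)
    rw [relLength_add_relLength le_sup_right hle1, hilbertFunction, hilbertFunction,
      hilbertFunction, relLength_add_relLength hx3 (Ideal.pow_le_pow_right (by omega)),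
      relLength_add_relLength (hx3.trans (Ideal.pow_le_pow_right (by omega)))
        (Ideal.pow_le_pow_right (by omega)),
      relLength_add_relLength (hx3.trans (Ideal.pow_le_pow_right (by omega)))
        (Ideal.pow_le_pow_right (by omega))]
    nth_rewrite 1 [← hx1 0]
    nth_rewrite 1 [← hx1 1]
    rw [← hx1 2, relLength_add_relLength (hmono 2) (hmono 1),
      relLength_add_relLength ((hmono 2).trans (hmono 1)) (hmono 0)]
    simp
  obtain ⟨n1, hn1⟩ := ENat.ne_top_iff_exists.1 (ENat.ne_top_of_add_eq_natCast h1).1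
  obtain ⟨n2, hn2⟩ := ENat.ne_top_iff_exists.1 (ENat.ne_top_of_add_eq_natCast h2).1
  obtain ⟨p, hp⟩ := ENat.ne_top_iff_exists.1 (ENat.ne_top_of_add_eq_natCast e1).1
  have hq' : relLength (maximalIdeal A ^ 4 ⊔ Ideal.span {x ^ 3}) (Ideal.span {x ^ 3}) ≠ ⊤ := by
    intro hc
    rw [hc] at e2
    simp only [add_top] at e2
    exact ENat.natCast_ne_top (e + (e + e)) (by exact_mod_cast e2.symm)
  obtain ⟨q, hq⟩ := ENat.ne_top_iff_exists.1 hq'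
  rw [hilbertFunction_zero, ← hn1, ← hn2, ← hp, ← hq] at e2
  rw [← hn1] at h1
  rw [← hn2] at h2
  rw [← hp] at e1
  norm_cast at h1 h2 e1 e2
  have hq2 : q = 2 := by omega
  subst hq2
  refine ⟨⟨p, 2, ?_, ?_, by omega⟩, ⟨2, 0, ?_, ?_, by norm_num⟩, ⟨0, 0, ?_, ?_, by norm_num⟩⟩
  · rw [key, Nat.sub_self, hsup0, hp]
  · rw [key, hsup 0, hq]
  · rw [key, hsup 0, hq]
  · rw [key, hsup 0, hsup 1]
    exact relLength_eq_zero_iff.2 le_rfl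
  · rw [key, hsup 0, hsup 1]
    exact relLength_eq_zero_iff.2 le_rfl
  · rw [key, hsup 1, hsup 2]
    exact relLength_eq_zero_iff.2 le_rfl

end AlmostMinimal

/-! ### Linear maps respecting gradings -/

section Graded

theorem injective_of_surjective_of_length_eq {A M N : Type*} [CommRing A] [AddCommGroup M]
    [Module A M] [AddCommGroup N] [Module A N] {f : M →ₗ[A] N} (hf : Function.Surjective f)
    (hlen : Module.length A M = Module.length A N) (hN : Module.length A N ≠ ⊤) :
    Function.Injective f := by
  have h := Module.length_eq_add_of_exact (LinearMap.ker f).subtype f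
    (Submodule.subtype_injective _) hf (LinearMap.exact_subtype_ker_map f)
  rw [hlen] at h
  have h0 : Module.length A (LinearMap.ker f) = 0 :=
    WithTop.add_right_cancel hN (h.symm.trans (zero_add _).symm)
  rw [Module.length_eq_zero_iff, Submodule.subsingleton_iff_eq_bot] at h0
  exact LinearMap.ker_eq_bot.1 h0

theorem length_range_eq {A M N P : Type*} [CommRing A] [AddCommGroup M] [Module A M]
    [AddCommGroup N] [Module A N] [AddCommGroup P] [Module A P] {f : M →ₗ[A] N} {g : N →ₗ[A] P}
    (hf : Function.Surjective f) (hg : Function.Injective g) :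
    Module.length A (LinearMap.range (g ∘ₗ f)) = Module.length A N := by
  rw [LinearMap.range_comp_of_range_eq_top g (LinearMap.range_eq_top.2 hf)]
  exact (LinearEquiv.ofInjective g hg).length_eq.symm

variable {A M N : Type*} [CommRing A] [AddCommGroup M] [Module A M] [AddCommGroup N] [Module A N]
  {P : ℕ → Submodule A M} {Q : ℕ → Submodule A N}

theorem map_eq_of_surjective_of_map_le (hP : ⨆ n, P n = ⊤) (hQ : iSupIndep Q) {Φ : M →ₗ[A] N}
    (hΦ : ∀ n, (P n).map Φ ≤ Q n) (hsurj : Function.Surjective Φ) (n : ℕ) :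
    (P n).map Φ = Q n := by
  refine le_antisymm (hΦ n) fun z hz => ?_
  obtain ⟨v, rfl⟩ := hsurj z
  have hv : v ∈ ⨆ n, P n := hP ▸ Submodule.mem_top
  obtain ⟨f, hf, rfl⟩ := (Submodule.mem_iSup_iff_exists_finsupp P v).1 hv
  refine ⟨f n, hf n, ?_⟩
  -- Inserting `n` keeps that degree in the sum even if the component `f n` is zero.
  set s := insert n f.support
  have hsum : Φ (f.sum fun _ v => v) = ∑ i ∈ s, Φ (f i) := by
    rw [Finsupp.sum, map_sum]
    refine Finset.sum_subset (Finset.subset_insert _ _) fun i _ hi => ?_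
    rw [Finsupp.notMem_support_iff.1 hi, map_zero]
  rw [hsum] at hz ⊢
  have hmem : ∀ i, Φ (f i) ∈ Q i := fun i => hΦ i ⟨f i, hf i, rfl⟩
  -- Subtracting the homogeneous element being lifted from the term of degree `n` gives a vanishing
  -- sum of homogeneous terms, so the component `f n` alone is a preimage.
  have hdiff := (iSupIndep_iff_finsetSum_eq_zero_imp_eq_zero Q).1 hQ s
    (fun i => Φ (f i) - if i = n then ∑ i ∈ s, Φ (f i) else 0) (fun i _ => ?_) ?_ n
    (Finset.mem_insert_self _ _)
  · simpa [sub_eq_zero] using hdiff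
  · split_ifs with h
    · subst h
      exact sub_mem (hmem i) hz
    · simpa using hmem i
  · rw [Finset.sum_sub_distrib, Finset.sum_ite_eq' s n, if_pos (Finset.mem_insert_self _ _),
      sub_self]

theorem injective_of_injective_on_pieces (hP : ⨆ n, P n = ⊤) (hQ : iSupIndep Q) {Φ : M →ₗ[A] N}
    (hΦ : ∀ n, (P n).map Φ ≤ Q n) (hinj : ∀ n, ∀ v ∈ P n, Φ v = 0 → v = 0) :
    Function.Injective Φ := by
  rw [injective_iff_map_eq_zero]
  intro v hv0
  have hv : v ∈ ⨆ n, P n := hP ▸ Submodule.mem_top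
  obtain ⟨f, hf, rfl⟩ := (Submodule.mem_iSup_iff_exists_finsupp P v).1 hv
  rw [Finsupp.sum, map_sum] at hv0
  have h := (iSupIndep_iff_finsetSum_eq_zero_imp_eq_zero Q).1 hQ f.support (fun i => Φ (f i))
    (fun i _ => hΦ i ⟨f i, hf i, rfl⟩) hv0
  exact Finset.sum_eq_zero fun i hi => hinj i _ (hf i) (h i hi)

end Graded

/-! ### Homogeneous components of the fiber rings -/

namespace FiberRing

variable {A : Type*} [CommRing A] (J I : Ideal A)

/-- The class in `Iⁿ / J Iⁿ` of an element of `Iⁿ`. -/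
noncomputable def single (n : ℕ) : ↥(I ^ n) →ₗ[A] FiberRing J I :=
  (mk J I).toLinearMap ∘ₗ
    LinearMap.codRestrict (Subalgebra.toSubmodule (reesAlgebra I))
      (Polynomial.monomial n ∘ₗ (I ^ n).subtype) fun a => reesAlgebra.monomial_mem.2 a.2

theorem single_apply (n : ℕ) (a : ↥(I ^ n)) :
    single J I n a = mk J I ⟨Polynomial.monomial n (a : A), reesAlgebra.monomial_mem.2 a.2⟩ :=
  rfl

variable {J I}

theorem single_mul_single {n k : ℕ} (a : ↥(I ^ n)) (b : ↥(I ^ k)) :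
    single J I n a * single J I k b =
      single J I (n + k) ⟨a * b, by rw [pow_add]; exact Ideal.mul_mem_mul a.2 b.2⟩ := by
  rw [single_apply, single_apply, single_apply, ← map_mul]
  congr 1
  ext1
  exact Polynomial.monomial_mul_monomial _ _ _ _

theorem single_congr {n k : ℕ} (h : n = k) {a : ↥(I ^ n)} {b : ↥(I ^ k)} (hab : (a : A) = b) :
    single J I n a = single J I k b := by
  subst h
  rw [Subtype.ext hab]

/-- This bounds the extended ideal degree by degree; it gives both that the component of degree `n`
is exactly `I^n / J I^n` and that the components are independent. -/
theorem coeff_mem_of_mem_map {f : reesAlgebra I}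
    (hf : f ∈ J.map (algebraMap A (reesAlgebra I))) :
    ∀ n, (f : A[X]).coeff n ∈ J * I ^ n := by
  refine Submodule.span_induction ?_ ?_ ?_ ?_ hf
  · rintro _ ⟨a, ha, rfl⟩ n
    change (Polynomial.C a).coeff n ∈ _
    rw [Polynomial.coeff_C]
    split_ifs with h
    · subst h
      simpa using ha
    · exact zero_mem _
  · simp
  · intro f g _ _ hf hg n
    simpa using add_mem (hf n) (hg n)
  · intro g f _ hf n
    rw [smul_eq_mul, MulMemClass.coe_mul, Polynomial.coeff_mul]
    refine sum_mem fun ij hij => ?_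
    rw [← Finset.HasAntidiagonal.mem_antidiagonal.1 hij, pow_add, mul_left_comm]
    exact Ideal.mul_mem_mul (g.2 _) (hf _)

theorem smul_eq_zero {a : A} (ha : a ∈ J) (f : FiberRing J I) : a • f = 0 := by
  rw [Algebra.smul_def]
  have h : algebraMap A (FiberRing J I) a = 0 :=
    Ideal.Quotient.eq_zero_iff_mem.2 (Ideal.mem_map_of_mem _ ha)
  rw [h, zero_mul]

theorem single_eq_zero_iff {n : ℕ} {a : ↥(I ^ n)} : single J I n a = 0 ↔ (a : A) ∈ J * I ^ n := by
  constructor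
  · intro h
    have h' := coeff_mem_of_mem_map (Ideal.Quotient.eq_zero_iff_mem.1 h) n
    change (Polynomial.monomial n (a : A)).coeff n ∈ _ at h'
    rwa [Polynomial.coeff_monomial_same] at h'
  · obtain ⟨a, ha⟩ := a
    intro h
    have key : ∀ (b : A) (hb : b ∈ J * I ^ n), single J I n ⟨b, Ideal.mul_le_right hb⟩ = 0 := by
      intro b hb
      refine Submodule.mul_induction_on' (C := fun b hb =>
        single J I n ⟨b, Ideal.mul_le_right hb⟩ = 0) ?_ ?_ hb
      · intro c hc d hd
        have h := smul_eq_zero hc (single J I n ⟨d, hd⟩)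
        rwa [← map_smul] at h
      · intro c hc d hd h1 h2
        have h := congrArg₂ (· + ·) h1 h2
        simp only [← map_add, add_zero] at h
        exact h
    exact key a h

theorem piece_eq_range (n : ℕ) : piece J I n = LinearMap.range (single J I n) := by
  ext z
  constructor
  · rintro ⟨⟨_, hf⟩, ⟨a, rfl⟩, rfl⟩
    exact ⟨⟨a, reesAlgebra.monomial_mem.1 hf⟩, rfl⟩
  · rintro ⟨a, rfl⟩
    exact ⟨⟨Polynomial.monomial n (a : A), reesAlgebra.monomial_mem.2 a.2⟩, ⟨a, rfl⟩, rfl⟩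

theorem iSup_piece : ⨆ n, piece J I n = ⊤ := by
  rw [eq_top_iff]
  intro z _
  obtain ⟨f, rfl⟩ := Ideal.Quotient.mk_surjective z
  have hf : f = ∑ n ∈ (f : A[X]).support,
      (⟨Polynomial.monomial n ((f : A[X]).coeff n), reesAlgebra.monomial_mem.2 (f.2 n)⟩ :
        reesAlgebra I) := by
    ext1
    rw [AddSubmonoidClass.coe_finsetSum]
    exact (f : A[X]).as_sum_support
  change mk J I f ∈ _
  rw [hf, map_sum]
  refine sum_mem fun n _ => Submodule.mem_iSup_of_mem n ?_
  rw [piece_eq_range]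
  exact ⟨⟨_, f.2 n⟩, rfl⟩

theorem iSupIndep_piece : iSupIndep (piece J I) := by
  rw [iSupIndep_iff_finsetSum_eq_zero_imp_eq_zero]
  intro s v hv hsum i hi
  have hv' : ∀ i : ℕ, ∃ a : ↥(I ^ i), i ∈ s → single J I i a = v i := fun i => by
    by_cases h : i ∈ s
    · have := hv i h
      rw [piece_eq_range] at this
      exact this.imp fun _ h _ => h
    · exact ⟨0, fun h' => absurd h' h⟩
  choose a ha using hv'
  rw [← ha i hi, single_eq_zero_iff]
  rw [← Finset.sum_congr rfl ha] at hsum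
  simp only [single_apply, ← map_sum] at hsum
  have h := coeff_mem_of_mem_map (Ideal.Quotient.eq_zero_iff_mem.1 hsum) i
  rw [AddSubmonoidClass.coe_finsetSum, Polynomial.finsetSum_coeff] at h
  simpa [Polynomial.coeff_monomial, hi] using h

theorem length_map_single {n : ℕ} {P : Ideal A} (hP : P ≤ I ^ n) :
    Module.length A (LinearMap.range (single J I n ∘ₗ Submodule.inclusion hP)) =
      relLength P (J * I ^ n) := by
  rw [relLength, ← (LinearMap.quotKerEquivRange _).length_eq]
  refine (Submodule.quotEquivOfEq _ _ ?_).length_eq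
  ext z
  rw [LinearMap.mem_ker, LinearMap.comp_apply, single_eq_zero_iff]
  rfl

theorem map_single {I' : Ideal A} (h : I ≤ I') (n : ℕ) (a : ↥(I ^ n)) :
    map J h (single J I n a) = single J I' n ⟨a, Ideal.pow_right_mono h n a.2⟩ :=
  rfl

end FiberRing

/-! ### Lengths of ranges -/

section Length

variable {A : Type*} [CommRing A]

theorem length_range_prodMap_piMap {ι κ : Type*} [Fintype ι] [Fintype κ]
    {M M' : ι → Type*} {N N' : κ → Type*} [∀ i, AddCommGroup (M i)] [∀ i, Module A (M i)]
    [∀ i, AddCommGroup (M' i)] [∀ i, Module A (M' i)] [∀ i, AddCommGroup (N i)]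
    [∀ i, Module A (N i)] [∀ i, AddCommGroup (N' i)] [∀ i, Module A (N' i)]
    (f : ∀ i, M i →ₗ[A] M' i) (g : ∀ i, N i →ₗ[A] N' i) :
    Module.length A (LinearMap.range ((LinearMap.piMap f).prodMap (LinearMap.piMap g))) =
      ∑ i, Module.length A (LinearMap.range (f i)) +
        ∑ i, Module.length A (LinearMap.range (g i)) := by
  have hcomp : (LinearMap.piMap f).prodMap (LinearMap.piMap g) =
      ((LinearMap.piMap fun i => (LinearMap.range (f i)).subtype).prodMap
        (LinearMap.piMap fun i => (LinearMap.range (g i)).subtype)) ∘ₗ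
      ((LinearMap.piMap fun i => (f i).rangeRestrict).prodMap
        (LinearMap.piMap fun i => (g i).rangeRestrict)) := rfl
  rw [hcomp, length_range_eq, Module.length_prod, Module.length_pi_of_fintype,
    Module.length_pi_of_fintype]
  · exact Function.Surjective.prodMap
      (Function.Surjective.piMap fun i => (f i).surjective_rangeRestrict)
      (Function.Surjective.piMap fun i => (g i).surjective_rangeRestrict)
  · exact Function.Injective.prodMap
      (Function.Injective.piMap fun i => Submodule.subtype_injective _)
      (Function.Injective.piMap fun i => Submodule.subtype_injective _)

theorem length_range_toSpanSingleton [IsLocalRing A] {M : Type*} [AddCommGroup M] [Module A M]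
    {v : M} (hv : ∀ a : A, a • v = 0 ↔ a ∈ maximalIdeal A) :
    Module.length A (LinearMap.range (LinearMap.toSpanSingleton A M v)) = 1 := by
  have hker : LinearMap.ker (LinearMap.toSpanSingleton A M v) = maximalIdeal A := by
    ext a
    exact hv a
  rw [← (LinearMap.quotKerEquivRange _).length_eq, hker]
  have : IsSimpleModule A (A ⧸ maximalIdeal A) :=
    isSimpleModule_iff_isCoatom.2 (maximalIdeal.isMaximal A).out
  exact Module.length_eq_one A (A ⧸ maximalIdeal A)

end Length

/-! ### `F(x)` as a polynomial ring in `x*` -/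

section NoetherNorm

variable {A : Type*} [CommRing A] [IsLocalRing A] {x : A}

theorem initialForm_pow (n : ℕ) : initialForm x ^ n =
    FiberRing.single (maximalIdeal A) (Ideal.span {x}) n
      ⟨x ^ n, Ideal.pow_mem_pow (Ideal.mem_span_singleton_self x) n⟩ := by
  induction n with
  | zero =>
    rw [pow_zero, FiberRing.single_apply,
      ← map_one (FiberRing.mk (maximalIdeal A) (Ideal.span {x}))]
    congr 1
    ext1
    exact (by simp : (1 : A[X]) = Polynomial.monomial 0 (x ^ 0))
  | succ n ih =>
    have h1 : initialForm x = FiberRing.single (maximalIdeal A) (Ideal.span {x}) 1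
      ⟨x, by rw [pow_one]; exact Ideal.mem_span_singleton_self x⟩ := rfl
    rw [pow_succ, ih, h1, FiberRing.single_mul_single]
    exact FiberRing.single_congr rfl (pow_succ x n).symm

theorem mem_piece_noetherNorm_iff {n : ℕ} {f : NoetherNorm x} :
    f ∈ FiberRing.piece (maximalIdeal A) (Ideal.span {x}) n ↔
      ∃ a : A, a • initialForm x ^ n = f := by
  rw [FiberRing.piece_eq_range, initialForm_pow]
  constructor
  · rintro ⟨⟨b, hb⟩, rfl⟩
    have hb' := hb
    rw [Ideal.span_singleton_pow, Ideal.mem_span_singleton'] at hb'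
    obtain ⟨a, rfl⟩ := hb'
    exact ⟨a, (map_smul _ _ _).symm⟩
  · rintro ⟨a, rfl⟩
    exact ⟨_, map_smul _ a _⟩

/-- Multiples of `(x*)^j` have no component of degree `n < j`, so `a x^n` lies in `x^n m`, and `x^n`
cancels. -/
theorem smul_initialForm_pow_mem_iff (hx : x ∈ nonZeroDivisors A) {n j : ℕ} (hnj : n < j) {a : A} :
    a • initialForm x ^ n ∈ Ideal.span {initialForm x ^ j} ↔ a ∈ maximalIdeal A := by
  refine ⟨fun h => ?_, fun h => ?_⟩
  · obtain ⟨g, hg⟩ := Ideal.mem_span_singleton'.1 h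
    obtain ⟨g, rfl⟩ := Ideal.Quotient.mk_surjective g
    change FiberRing.mk _ _ g * _ = _ at hg
    rw [initialForm_pow, initialForm_pow, ← map_smul, FiberRing.single_apply,
      FiberRing.single_apply, ← map_mul, ← sub_eq_zero, ← map_sub] at hg
    have h' := FiberRing.coeff_mem_of_mem_map (Ideal.Quotient.eq_zero_iff_mem.1 hg) n
    change ((g : A[X]) * Polynomial.monomial j (x ^ j) -
      Polynomial.monomial n (a * x ^ n)).coeff n ∈ _ at h'
    rw [Polynomial.coeff_sub, ← Polynomial.C_mul_X_pow_eq_monomial (n := j), ← mul_assoc,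
      Polynomial.coeff_mul_X_pow', if_neg (by omega), zero_sub, neg_mem_iff, Polynomial.coeff_monomial_same,
      Ideal.span_singleton_pow, mul_comm (maximalIdeal A)] at h'
    rwa [mul_comm a, mul_mem_span_singleton_mul_iff (pow_mem hx n)] at h'
  · rw [FiberRing.smul_eq_zero h]
    exact zero_mem _

theorem smul_initialForm_pow_eq_zero_iff (hx : x ∈ nonZeroDivisors A) {n : ℕ} {a : A} :
    a • initialForm x ^ n = 0 ↔ a ∈ maximalIdeal A :=
  ⟨fun h => (smul_initialForm_pow_mem_iff hx n.lt_succ_self).1 (h ▸ zero_mem _),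
    fun h => FiberRing.smul_eq_zero h _⟩

end NoetherNorm

/-! ### Homogeneous components of the decomposition module -/

namespace DecompModule

variable {A : Type*} [CommRing A] [IsLocalRing A]

/-- The map sending coefficients `c` to the element of degree `n` of the decomposition module
whose components at the summands generated in degrees `i ≤ s` are `c (x*)ⁿ⁻ⁱ`, the others being
zero. -/
noncomputable def monomialMap (x : A) (r : ℕ) (α : ℕ → ℕ) (τ : ℕ → ℕ → ℕ) (s n : ℕ) :
    ((FreeIndex r α → A) × (TorsionIndex r τ → A)) →ₗ[A] DecompModule x r α τ :=
  LinearMap.prodMap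
    (LinearMap.piMap fun p => LinearMap.toSpanSingleton A (NoetherNorm x)
      (if (p.1 : ℕ) ≤ s then initialForm x ^ (n - p.1) else 0))
    (LinearMap.piMap fun q => LinearMap.toSpanSingleton A
      (NoetherNorm x ⧸ Ideal.span {initialForm x ^ (q.2.1 : ℕ)})
      (if (q.1 : ℕ) ≤ s then Ideal.Quotient.mk _ (initialForm x ^ (n - q.1)) else 0))

variable {x : A} {r : ℕ} {α : ℕ → ℕ} {τ : ℕ → ℕ → ℕ}

theorem monomialMap_apply_fst (s n : ℕ) (v : (FreeIndex r α → A) × (TorsionIndex r τ → A))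
    (p : FreeIndex r α) : (monomialMap x r α τ s n v).1 p =
      v.1 p • if (p.1 : ℕ) ≤ s then initialForm x ^ (n - p.1) else 0 :=
  rfl

theorem monomialMap_apply_snd (s n : ℕ) (v : (FreeIndex r α → A) × (TorsionIndex r τ → A))
    (q : TorsionIndex r τ) : (monomialMap x r α τ s n v).2 q =
      v.2 q • if (q.1 : ℕ) ≤ s then Ideal.Quotient.mk _ (initialForm x ^ (n - q.1)) else 0 :=
  rfl

/-- For `s = n` this measures the whole component of degree `n`; for `s < n` it measures
`(x*)^(n-s)` times the component of degree `s`. A torsion summand of order `j` contributes only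
while the exponent of `x*` is below `j`. -/
theorem length_range_monomialMap (hx : x ∈ nonZeroDivisors A) (s n : ℕ) :
    Module.length A (LinearMap.range (monomialMap x r α τ s n)) =
      ∑ p : FreeIndex r α, (if (p.1 : ℕ) ≤ s then 1 else 0) +
        ∑ q : TorsionIndex r τ, (if (q.1 : ℕ) ≤ s ∧ n - q.1 < q.2.1 then 1 else 0) := by
  rw [monomialMap, length_range_prodMap_piMap]
  congr 1
  · refine Finset.sum_congr rfl fun p _ => ?_
    by_cases h : (p.1 : ℕ) ≤ s
    · rw [if_pos h, if_pos h]
      exact length_range_toSpanSingleton fun a => smul_initialForm_pow_eq_zero_iff hx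
    · rw [if_neg h, if_neg h, LinearMap.toSpanSingleton_zero, LinearMap.range_zero, Module.length_bot]
  · refine Finset.sum_congr rfl fun q _ => ?_
    by_cases h : (q.1 : ℕ) ≤ s
    · rw [if_pos h]
      by_cases h' : n - q.1 < q.2.1
      · rw [if_pos ⟨h, h'⟩]
        refine length_range_toSpanSingleton fun a => ?_
        rw [← smul_initialForm_pow_mem_iff hx h', ← Ideal.Quotient.eq_zero_iff_mem]
        rfl
      · rw [if_neg fun hc => h' hc.2, Ideal.Quotient.eq_zero_iff_mem.2,
          LinearMap.toSpanSingleton_zero, LinearMap.range_zero, Module.length_bot]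
        exact Ideal.mem_span_singleton.2 (pow_dvd_pow _ (not_lt.1 h'))
    · rw [if_neg h, if_neg fun hc => h hc.1, LinearMap.toSpanSingleton_zero, LinearMap.range_zero,
        Module.length_bot]

theorem isHomogeneousOfDegree_monomialMap (n : ℕ)
    (v : (FreeIndex r α → A) × (TorsionIndex r τ → A)) :
    (monomialMap x r α τ n n v).IsHomogeneousOfDegree n := by
  refine ⟨fun p => ?_, fun q => ?_⟩
  · rw [monomialMap_apply_fst, FiberRing.shiftedPiece]
    split_ifs
    · exact mem_piece_noetherNorm_iff.2 ⟨_, rfl⟩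
    · simp
  · rw [monomialMap_apply_snd, FiberRing.shiftedPiece]
    split_ifs
    · exact ⟨_, mem_piece_noetherNorm_iff.2 ⟨v.2 q, rfl⟩, rfl⟩
    · exact ⟨0, by simp, by simp⟩

theorem initialForm_pow_smul_monomialMap {s n : ℕ} (hsn : s ≤ n) (k : ℕ)
    (v : (FreeIndex r α → A) × (TorsionIndex r τ → A)) :
    initialForm x ^ k • monomialMap x r α τ s n v = monomialMap x r α τ s (n + k) v := by
  refine Prod.ext (funext fun p => ?_) (funext fun q => ?_)
  · rw [Prod.smul_fst, Pi.smul_apply, monomialMap_apply_fst, monomialMap_apply_fst]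
    split_ifs with h
    · rw [smul_comm, smul_eq_mul, ← pow_add]
      congr 2
      omega
    · simp
  · rw [Prod.smul_snd, Pi.smul_apply, monomialMap_apply_snd, monomialMap_apply_snd]
    split_ifs with h
    · rw [smul_comm]
      congr 1
      refine congrArg (Ideal.Quotient.mk _) ?_
      change initialForm x ^ k * initialForm x ^ (n - q.1) = _
      rw [← pow_add]
      congr 1
      omega
    · simp

theorem iSup_range_monomialMap : ⨆ n, LinearMap.range (monomialMap x r α τ n n) = ⊤ := by
  classical
  have hfree : ∀ (p : FreeIndex r α) (f : NoetherNorm x),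
      ((Pi.single p f, 0) : DecompModule x r α τ) ∈
        ⨆ n, LinearMap.range (monomialMap x r α τ n n) := by
    intro p f
    have hf : f ∈ ⨆ n, FiberRing.piece (maximalIdeal A) (Ideal.span {x}) n :=
      by rw [FiberRing.iSup_piece]; trivial
    refine Submodule.iSup_induction _
      (motive := fun f => ((Pi.single p f, 0) : DecompModule x r α τ) ∈
        ⨆ n, LinearMap.range (monomialMap x r α τ n n)) hf ?_ ?_ ?_
    · intro n f hf
      obtain ⟨a, rfl⟩ := mem_piece_noetherNorm_iff.1 hf
      refine Submodule.mem_iSup_of_mem (n + p.1) ⟨(Pi.single p a, 0), ?_⟩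
      refine Prod.ext (funext fun p' => ?_) (funext fun q => ?_)
      · rw [monomialMap_apply_fst]
        by_cases h : p' = p
        · subst h
          simp
        · simp [Pi.single_eq_of_ne h]
      · rw [monomialMap_apply_snd]
        simp
    · simp only [Pi.single_zero]
      exact zero_mem (⨆ n, LinearMap.range (monomialMap x r α τ n n))
    · intro f g hf hg
      convert add_mem hf hg using 1
      rw [Prod.mk_add_mk, ← Pi.single_add, add_zero]
  have htors : ∀ (q : TorsionIndex r τ) (f : NoetherNorm x),
      ((0, Pi.single q (Ideal.Quotient.mk _ f)) : DecompModule x r α τ) ∈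
        ⨆ n, LinearMap.range (monomialMap x r α τ n n) := by
    intro q f
    have hf : f ∈ ⨆ n, FiberRing.piece (maximalIdeal A) (Ideal.span {x}) n :=
      by rw [FiberRing.iSup_piece]; trivial
    refine Submodule.iSup_induction _
      (motive := fun f => ((0, Pi.single q (Ideal.Quotient.mk _ f)) : DecompModule x r α τ) ∈
        ⨆ n, LinearMap.range (monomialMap x r α τ n n)) hf ?_ ?_ ?_
    · intro n f hf
      obtain ⟨a, rfl⟩ := mem_piece_noetherNorm_iff.1 hf
      refine Submodule.mem_iSup_of_mem (n + q.1) ⟨(0, Pi.single q a), ?_⟩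
      refine Prod.ext (funext fun p => ?_) (funext fun q' => ?_)
      · rw [monomialMap_apply_fst]
        simp
      · rw [monomialMap_apply_snd]
        by_cases h : q' = q
        · subst h
          simp only [Pi.single_eq_same, le_add_iff_nonneg_left, zero_le, if_true,
            Nat.add_sub_cancel]
          rfl
        · simp [Pi.single_eq_of_ne h]
    · simp only [map_zero, Pi.single_zero]
      exact zero_mem (⨆ n, LinearMap.range (monomialMap x r α τ n n))
    · intro f g hf hg
      convert add_mem hf hg using 1
      rw [Prod.mk_add_mk, ← Pi.single_add, add_zero, map_add]
  rw [eq_top_iff]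
  rintro ⟨f, t⟩ -
  have hdec : ((f, t) : DecompModule x r α τ) =
      ∑ p, (Pi.single p (f p), 0) + ∑ q, (0, Pi.single q (t q)) := by
    refine Prod.ext ?_ ?_
    · simp [Prod.fst_sum, Finset.univ_sum_single]
    · simp [Prod.snd_sum, Finset.univ_sum_single]
  rw [hdec]
  refine add_mem (sum_mem fun p _ => hfree p _) (sum_mem fun q _ => ?_)
  obtain ⟨g, hg⟩ := Ideal.Quotient.mk_surjective (t q)
  rw [← hg]
  exact htors q g

end DecompModule

theorem sum_freeIndex {N : Type*} [AddCommMonoid N] (r : ℕ) (α : ℕ → ℕ) (f : ℕ → N) :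
    ∑ p : FreeIndex r α, f p.1 = ∑ i ∈ Finset.range (r + 1), α i • f i := by
  rw [Fintype.sum_sigma, ← Fin.sum_univ_eq_sum_range (fun i => α i • f i)]
  simp

theorem sum_torsionIndex {N : Type*} [AddCommMonoid N] (r : ℕ) (τ : ℕ → ℕ → ℕ) (f : ℕ → ℕ → N) :
    ∑ q : TorsionIndex r τ, f q.1 q.2.1 =
      ∑ i ∈ Finset.Icc 1 (r - 1), ∑ j ∈ Finset.Icc 1 (r - i), τ i j • f i j := by
  rw [Fintype.sum_sigma, ← Finset.sum_coe_sort (Finset.Icc 1 (r - 1))]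
  refine Finset.sum_congr rfl fun i _ => ?_
  rw [Fintype.sum_sigma, ← Finset.sum_coe_sort (Finset.Icc 1 (r - i))]
  simp

/-- The universal property of a direct sum of cyclic modules. The conclusion is an additive map, so
that the module structure of `S` through `φ` stays local to the proof. -/
theorem exists_addMonoidHom_prod_quotient {R S ι κ : Type*} [CommRing R] [CommRing S] [Fintype ι]
    [Fintype κ] (φ : R →+* S) (J : κ → Ideal R) (g : ι → S) (h : κ → S)
    (hh : ∀ q, ∀ c ∈ J q, φ c * h q = 0) :
    ∃ Φ : (ι → R) × (∀ q, R ⧸ J q) →+ S, (∀ (c : R) z, Φ (c • z) = φ c * Φ z) ∧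
      ∀ (f : ι → R) (t : κ → R), Φ (f, fun q => Ideal.Quotient.mk _ (t q)) =
        ∑ p, φ (f p) * g p + ∑ q, φ (t q) * h q := by
  let _ : Module R S := Module.compHom S φ
  let Ψ : (ι → R) × (∀ q, R ⧸ J q) →ₗ[R] S := LinearMap.coprod
    (∑ p, (LinearMap.toSpanSingleton R S (g p)) ∘ₗ LinearMap.proj p)
    (∑ q, (Submodule.liftQ (J q) (LinearMap.toSpanSingleton R S (h q)) (hh q)) ∘ₗ
      LinearMap.proj q)
  refine ⟨Ψ.toAddMonoidHom, fun c z => Ψ.map_smul c z, fun f t => ?_⟩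
  change Ψ (f, fun q => Ideal.Quotient.mk _ (t q)) = _
  simp only [Ψ, LinearMap.coprod_apply, LinearMap.sum_apply]
  rfl

/-! ### Comparing the decomposition module with the tangent cone -/

section TangentCone

variable {A : Type*} [CommRing A] [IsLocalRing A]

theorem length_piece_tangentCone (n : ℕ) :
    Module.length A (FiberRing.piece (maximalIdeal A) (maximalIdeal A) n) =
      hilbertFunction A n := by
  rw [hilbertFunction, pow_succ', ← FiberRing.length_map_single le_rfl, FiberRing.piece_eq_range]
  rfl

theorem single_tangentCone_eq_zero_iff {n : ℕ} {a : ↥(maximalIdeal A ^ n)} :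
    FiberRing.single (maximalIdeal A) (maximalIdeal A) n a = 0 ↔
      (a : A) ∈ maximalIdeal A ^ (n + 1) := by
  rw [FiberRing.single_eq_zero_iff, pow_succ']

variable {x : A} {r : ℕ} {α : ℕ → ℕ} {τ : ℕ → ℕ → ℕ}

theorem map_initialForm_pow (hx : Ideal.span {x} ≤ maximalIdeal A) (k : ℕ) :
    FiberRing.map (maximalIdeal A) hx (initialForm x ^ k) =
      FiberRing.single (maximalIdeal A) (maximalIdeal A) k ⟨x ^ k,
        Ideal.pow_mem_pow (hx (Ideal.mem_span_singleton_self x)) k⟩ := by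
  rw [initialForm_pow, FiberRing.map_single]

theorem map_mul_single_mem_piece (hx : Ideal.span {x} ≤ maximalIdeal A) {i n : ℕ}
    {f : NoetherNorm x}
    (hf : f ∈ FiberRing.shiftedPiece (maximalIdeal A) (Ideal.span {x}) i n)
    (a : ↥(maximalIdeal A ^ i)) :
    FiberRing.map (maximalIdeal A) hx f * FiberRing.single (maximalIdeal A) (maximalIdeal A) i a ∈
      FiberRing.piece (maximalIdeal A) (maximalIdeal A) n := by
  rw [FiberRing.shiftedPiece] at hf
  split_ifs at hf with h
  · rw [FiberRing.piece_eq_range] at hf ⊢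
    obtain ⟨b, rfl⟩ := hf
    rw [FiberRing.map_single, FiberRing.single_mul_single]
    have hba : (b : A) * a ∈ maximalIdeal A ^ (n - i + i) := by
      rw [pow_add]
      exact Ideal.mul_mem_mul (Ideal.pow_right_mono hx _ b.2) a.2
    rw [Nat.sub_add_cancel h] at hba
    exact ⟨⟨b * a, hba⟩, FiberRing.single_congr (Nat.sub_add_cancel h).symm rfl⟩
  · rw [(Submodule.mem_bot A).1 hf, map_zero, zero_mul]
    exact zero_mem _

/-- A homomorphism over `F(x)` from the decomposition module to the tangent cone, as an `A`-linear
map. -/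
def DecompModule.toLinearMap (hx : Ideal.span {x} ≤ maximalIdeal A)
    (Φ : DecompModule x r α τ →+ TangentCone A)
    (hΦ : ∀ (c : NoetherNorm x) (z : DecompModule x r α τ),
      Φ (c • z) = FiberRing.map (maximalIdeal A) hx c * Φ z) :
    DecompModule x r α τ →ₗ[A] TangentCone A :=
  { Φ with
    map_smul' := fun a z => by
      have h := hΦ (algebraMap A _ a) z
      rwa [algebraMap_smul, AlgHom.commutes, ← Algebra.smul_def] at h }

theorem DecompModule.map_range_monomialMap_le {Φ : DecompModule x r α τ →ₗ[A] TangentCone A}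
    (hgr : ∀ (n : ℕ) (z : DecompModule x r α τ), z.IsHomogeneousOfDegree n →
      Φ z ∈ FiberRing.piece (maximalIdeal A) (maximalIdeal A) n) (n : ℕ) :
    (LinearMap.range (monomialMap x r α τ n n)).map Φ ≤
      FiberRing.piece (maximalIdeal A) (maximalIdeal A) n := by
  rintro _ ⟨_, ⟨v, rfl⟩, rfl⟩
  exact hgr n _ (isHomogeneousOfDegree_monomialMap n v)

/-- A graded surjection is surjective in each degree, and a surjection between modules of equal
finite length is injective. -/
theorem hasTangentConeInvariants_of_surjective (hx : Ideal.span {x} ≤ maximalIdeal A)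
    (Φ : DecompModule x r α τ →+ TangentCone A)
    (hΦ : ∀ (c : NoetherNorm x) (z : DecompModule x r α τ),
      Φ (c • z) = FiberRing.map (maximalIdeal A) hx c * Φ z)
    (hgr : ∀ (n : ℕ) (z : DecompModule x r α τ), z.IsHomogeneousOfDegree n →
      Φ z ∈ FiberRing.piece (maximalIdeal A) (maximalIdeal A) n)
    (hsurj : Function.Surjective Φ) (hfin : ∀ n, hilbertFunction A n ≠ ⊤)
    (hlen : ∀ n, Module.length A (LinearMap.range (DecompModule.monomialMap x r α τ n n)) =
      hilbertFunction A n) :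
    HasTangentConeInvariants x hx r α τ := by
  set Ψ := DecompModule.toLinearMap hx Φ hΦ
  have hle := DecompModule.map_range_monomialMap_le (Φ := Ψ) hgr
  have hmap := map_eq_of_surjective_of_map_le DecompModule.iSup_range_monomialMap
    FiberRing.iSupIndep_piece hle hsurj
  have hinj : Function.Injective Ψ := by
    refine injective_of_injective_on_pieces DecompModule.iSup_range_monomialMap
      FiberRing.iSupIndep_piece hle fun n v hv hv0 => ?_
    have hres : ∀ z ∈ LinearMap.range (DecompModule.monomialMap x r α τ n n),
        Ψ z ∈ FiberRing.piece (maximalIdeal A) (maximalIdeal A) n :=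
      fun z hz => hle n ⟨z, hz, rfl⟩
    have hi : Function.Injective (Ψ.restrict hres) := by
      refine injective_of_surjective_of_length_eq ?_ ?_ ?_
      · rintro ⟨z, hz⟩
        rw [← hmap n] at hz
        obtain ⟨v, hv, rfl⟩ := hz
        exact ⟨⟨v, hv⟩, rfl⟩
      · rw [hlen, length_piece_tangentCone]
      · rw [length_piece_tangentCone]
        exact hfin n
    exact congrArg Subtype.val ((injective_iff_map_eq_zero _).1 hi ⟨v, hv⟩ (Subtype.ext hv0))
  exact ⟨AddEquiv.ofBijective Φ ⟨hinj, hsurj⟩, hΦ, hgr⟩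

/-- Both sides are the length of `(x*)^k G_s` inside `G_(s+k)`, the left one read in the
decomposition and the right one in `A`. These numbers do not depend on the decomposition, which is
what pins down the invariants. -/
theorem length_range_monomialMap_of_hasTangentConeInvariants
    {hx : Ideal.span {x} ≤ maximalIdeal A} (h : HasTangentConeInvariants x hx r α τ) (s k : ℕ) :
    Module.length A (LinearMap.range (DecompModule.monomialMap x r α τ s (s + k))) =
      relLength (Ideal.span {x ^ k} * maximalIdeal A ^ s ⊔ maximalIdeal A ^ (s + k + 1))
        (maximalIdeal A ^ (s + k + 1)) := by
  obtain ⟨Φ, hΦ, hgr⟩ := h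
  set Ψ := DecompModule.toLinearMap hx Φ.toAddMonoidHom hΦ
  have hmap := map_eq_of_surjective_of_map_le DecompModule.iSup_range_monomialMap
    FiberRing.iSupIndep_piece (DecompModule.map_range_monomialMap_le (Φ := Ψ) hgr) Φ.surjective
  have hxk : x ^ k ∈ maximalIdeal A ^ k :=
    Ideal.pow_mem_pow (hx (Ideal.mem_span_singleton_self x)) k
  have hP : Ideal.span {x ^ k} * maximalIdeal A ^ s ⊔ maximalIdeal A ^ (s + k + 1) ≤
      maximalIdeal A ^ (s + k) := by
    refine sup_le ?_ (Ideal.pow_le_pow_right (Nat.le_succ _))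
    rw [add_comm s, pow_add]
    exact Ideal.mul_mono_left ((Ideal.span_singleton_le_iff_mem _).2 hxk)
  have hmul : ∀ (v) (a : ↥(maximalIdeal A ^ s)),
      Ψ (DecompModule.monomialMap x r α τ s s v) =
        FiberRing.single (maximalIdeal A) (maximalIdeal A) s a →
      ∀ b : ↥(maximalIdeal A ^ (s + k)), x ^ k * a = b →
      Ψ (DecompModule.monomialMap x r α τ s (s + k) v) =
        FiberRing.single (maximalIdeal A) (maximalIdeal A) (s + k) b := by
    intro v a ha b hb
    rw [← DecompModule.initialForm_pow_smul_monomialMap le_rfl]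
    refine (hΦ _ _).trans ?_
    change _ * Ψ _ = _
    rw [ha, map_initialForm_pow, FiberRing.single_mul_single]
    exact FiberRing.single_congr (add_comm k s) hb
  have hrange : (LinearMap.range (DecompModule.monomialMap x r α τ s (s + k))).map Ψ =
      LinearMap.range (FiberRing.single (maximalIdeal A) (maximalIdeal A) (s + k) ∘ₗ
        Submodule.inclusion hP) := by
    apply le_antisymm
    · rintro _ ⟨_, ⟨v, rfl⟩, rfl⟩
      have hv : Ψ (DecompModule.monomialMap x r α τ s s v) ∈
          FiberRing.piece (maximalIdeal A) (maximalIdeal A) s := by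
        rw [← hmap s]
        exact ⟨_, ⟨v, rfl⟩, rfl⟩
      rw [FiberRing.piece_eq_range] at hv
      obtain ⟨a, ha⟩ := hv
      have hmem : x ^ k * (a : A) ∈ Ideal.span {x ^ k} * maximalIdeal A ^ s ⊔
          maximalIdeal A ^ (s + k + 1) :=
        Submodule.mem_sup_left (Ideal.mul_mem_mul (Ideal.mem_span_singleton_self _) a.2)
      exact ⟨⟨_, hmem⟩, (hmul v a ha.symm ⟨_, hP hmem⟩ rfl).symm⟩
    · rintro _ ⟨⟨b, hb⟩, rfl⟩
      obtain ⟨u, hu, c, hc, rfl⟩ := Submodule.mem_sup.1 hb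
      obtain ⟨a, ha, rfl⟩ := Ideal.mem_span_singleton_mul.1 hu
      have hv : FiberRing.single (maximalIdeal A) (maximalIdeal A) s ⟨a, ha⟩ ∈
          (LinearMap.range (DecompModule.monomialMap x r α τ s s)).map Ψ := by
        rw [hmap s, FiberRing.piece_eq_range]
        exact ⟨_, rfl⟩
      obtain ⟨_, ⟨v, rfl⟩, hv⟩ := hv
      refine ⟨_, ⟨v, rfl⟩, ?_⟩
      have hu' := hP (Submodule.mem_sup_left hu)
      rw [hmul v ⟨a, ha⟩ hv ⟨_, hu'⟩ rfl, ← sub_eq_zero, LinearMap.comp_apply, ← map_sub,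
        single_tangentCone_eq_zero_iff]
      change x ^ k * a - (x ^ k * a + c) ∈ _
      simpa using hc
  have hinj : Function.Injective Ψ := Φ.injective
  rw [(Submodule.equivMapOfInjective Ψ hinj _).length_eq, hrange, FiberRing.length_map_single,
    ← pow_succ']

end TangentCone

/-! ### Existence of the decomposition and its invariants -/

section Existence

variable {A : Type*} [CommRing A] [IsLocalRing A] {x : A} {r : ℕ} {α : ℕ → ℕ} {τ : ℕ → ℕ → ℕ}

/-- The condition `hh` says that `(x*)^j` kills the initial form chosen for a torsion summand of
order `j`. -/
theorem exists_gradedHom_tangentCone (hx : Ideal.span {x} ≤ maximalIdeal A)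
    (g : ∀ p : FreeIndex r α, ↥(maximalIdeal A ^ (p.1 : ℕ)))
    (h : ∀ q : TorsionIndex r τ, ↥(maximalIdeal A ^ (q.1 : ℕ)))
    (hh : ∀ q, x ^ (q.2.1 : ℕ) * (h q : A) ∈ maximalIdeal A ^ (q.2.1 + q.1 + 1 : ℕ)) :
    ∃ Φ : DecompModule x r α τ →+ TangentCone A,
      (∀ (c : NoetherNorm x) (z : DecompModule x r α τ),
        Φ (c • z) = FiberRing.map (maximalIdeal A) hx c * Φ z) ∧
      (∀ (n : ℕ) (z : DecompModule x r α τ), z.IsHomogeneousOfDegree n →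
        Φ z ∈ FiberRing.piece (maximalIdeal A) (maximalIdeal A) n) ∧
      (∀ p, ∃ z, Φ z = FiberRing.single (maximalIdeal A) (maximalIdeal A) p.1 (g p)) ∧
      ∀ q, ∃ z, Φ z = FiberRing.single (maximalIdeal A) (maximalIdeal A) q.1 (h q) := by
  classical
  obtain ⟨Φ, hΦ, hΦ'⟩ := exists_addMonoidHom_prod_quotient
    (FiberRing.map (maximalIdeal A) hx).toRingHom
    (fun q : TorsionIndex r τ => Ideal.span {initialForm x ^ (q.2.1 : ℕ)})
    (fun p : FreeIndex r α => FiberRing.single (maximalIdeal A) (maximalIdeal A) p.1 (g p))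
    (fun q => FiberRing.single (maximalIdeal A) (maximalIdeal A) q.1 (h q)) (by
      intro q c hc
      obtain ⟨c, rfl⟩ := Ideal.mem_span_singleton'.1 hc
      change FiberRing.map (maximalIdeal A) hx _ * _ = 0
      rw [map_mul, map_initialForm_pow, mul_assoc, FiberRing.single_mul_single,
        single_tangentCone_eq_zero_iff.2 (hh q), mul_zero])
  refine ⟨Φ, hΦ, fun n z hz => ?_, fun p => ⟨(Pi.single p 1, 0), ?_⟩,
    fun q => ⟨(0, Pi.single q 1), ?_⟩⟩
  · obtain ⟨f, t⟩ := z
    obtain ⟨hf, ht⟩ := hz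
    choose s hs hst using ht
    obtain rfl : (fun q => Ideal.Quotient.mk _ (s q)) = t := funext hst
    rw [hΦ' f s]
    exact add_mem (sum_mem fun p _ => map_mul_single_mem_piece hx (hf p) (g p))
      (sum_mem fun q _ => map_mul_single_mem_piece hx (hs q) (h q))
  · have h1 := hΦ' (Pi.single p 1) 0
    simp only [Pi.zero_apply, map_zero, zero_mul, Finset.sum_const_zero, add_zero] at h1
    refine h1.trans ?_
    rw [Finset.sum_eq_single p]
    · rw [Pi.single_eq_same, map_one, one_mul]
    · intro p' _ hp'
      rw [Pi.single_eq_of_ne hp', map_zero, zero_mul]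
    · simp
  · have h1 := hΦ' 0 (Pi.single q 1)
    simp only [Pi.zero_apply, map_zero, zero_mul, Finset.sum_const_zero, zero_add] at h1
    have h2 : (fun q' => Ideal.Quotient.mk (Ideal.span {initialForm x ^ (q'.2.1 : ℕ)})
        ((Pi.single q 1 : TorsionIndex r τ → NoetherNorm x) q')) = Pi.single q 1 := by
      funext q'
      by_cases hq : q' = q
      · subst hq
        simp
      · simp [Pi.single_eq_of_ne hq]
    rw [h2] at h1
    refine h1.trans ?_
    rw [Finset.sum_eq_single q]
    · rw [Pi.single_eq_same, map_one, one_mul]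
    · intro q' _ hq'
      rw [Pi.single_eq_of_ne hq', map_zero, zero_mul]
    · simp

/-- The elements of `𝔪ⁿ` whose class in the tangent cone lies in a given submodule. -/
noncomputable def initialIdeal (N : Submodule A (TangentCone A)) (n : ℕ) : Ideal A :=
  Submodule.map (maximalIdeal A ^ n).subtype
    (N.comap (FiberRing.single (maximalIdeal A) (maximalIdeal A) n))

theorem mem_initialIdeal {N : Submodule A (TangentCone A)} {n : ℕ} {a : A} :
    a ∈ initialIdeal N n ↔ ∃ h : a ∈ maximalIdeal A ^ n,
      FiberRing.single (maximalIdeal A) (maximalIdeal A) n ⟨a, h⟩ ∈ N := by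
  constructor
  · rintro ⟨⟨a, ha⟩, h, rfl⟩
    exact ⟨ha, h⟩
  · rintro ⟨ha, h⟩
    exact ⟨⟨a, ha⟩, h, rfl⟩

theorem pow_succ_le_initialIdeal (N : Submodule A (TangentCone A)) (n : ℕ) :
    maximalIdeal A ^ (n + 1) ≤ initialIdeal N n := fun a ha =>
  mem_initialIdeal.2 ⟨Ideal.pow_le_pow_right n.le_succ ha, by
    rw [single_tangentCone_eq_zero_iff.2 ha]
    exact zero_mem _⟩

theorem eq_top_of_pow_le_initialIdeal {N : Submodule A (TangentCone A)}
    (h : ∀ n, maximalIdeal A ^ n ≤ initialIdeal N n) : N = ⊤ := by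
  rw [eq_top_iff, ← FiberRing.iSup_piece]
  refine iSup_le fun n => ?_
  rw [FiberRing.piece_eq_range]
  rintro _ ⟨⟨a, ha⟩, rfl⟩
  exact (mem_initialIdeal.1 (h n ha)).2

/-- `m / m^2` has dimension `e - 1`, and the classes of `x` and `h` are independent there, leaving
`e - 3` further generators. -/
theorem exists_generators_maximalIdeal {e : ℕ}
    [IsNoetherianRing A] (h1 : hilbertFunction A 1 + 1 = e) {y w h : A}
    (S : IsAlmostMinimalSystem x y w h) :
    ∃ d : ℕ, d + 3 = e ∧ ∃ g : Fin d → A, maximalIdeal A =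
      (maximalIdeal A ^ 2 ⊔ Ideal.span {x} ⊔ Ideal.span {h}) ⊔ Ideal.span (Set.range g) := by
  have hle : maximalIdeal A ^ 2 ⊔ Ideal.span {x} ⊔ Ideal.span {h} ≤ maximalIdeal A :=
    sup_le (sup_le (Ideal.pow_le_self two_ne_zero) S.reduction.1)
      ((Ideal.span_singleton_le_iff_mem _).2 S.h_mem)
  have e1 := relLength_pow_sup_span_pow S.nonZeroDivisors S.reduction 1
  rw [pow_one, one_add_one_eq_two] at e1
  have e2 : relLength (maximalIdeal A ^ 2 ⊔ Ideal.span {x} ⊔ Ideal.span {h})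
      (maximalIdeal A ^ 2 ⊔ Ideal.span {x}) = 1 := by
    refine relLength_sup_span_singleton (fun a ha => Submodule.mem_sup_left ?_) ?_
    · rw [pow_two]
      exact Ideal.mul_mem_mul ha S.h_mem
    · rw [sup_comm]
      exact S.h_notMem
  have e3 : relLength (maximalIdeal A)
      (maximalIdeal A ^ 2 ⊔ Ideal.span {x} ⊔ Ideal.span {h}) + 1 + 1 = hilbertFunction A 1 := by
    nth_rewrite 2 [← e1]
    rw [← e2, relLength_add_relLength le_sup_left hle,
      relLength_add_relLength le_sup_left (le_sup_left.trans hle), hilbertFunction, pow_one]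
  rw [← e3, add_assoc, add_assoc] at h1
  obtain ⟨d, hd⟩ := ENat.ne_top_iff_exists.1 (ENat.ne_top_of_add_eq_natCast h1).1
  obtain ⟨g, hg⟩ := exists_generators_of_relLength_eq d hle (fun a ha p hp =>
    Submodule.mem_sup_left (Submodule.mem_sup_left (by
      rw [pow_two]
      exact Ideal.mul_mem_mul ha hp))) hd.symm
  refine ⟨d, ?_, g, hg⟩
  rw [← hd] at h1
  norm_cast at h1

theorem span_singleton_mul_le_initialIdeal {hx : Ideal.span {x} ≤ maximalIdeal A}
    {Φ : DecompModule x r α τ →ₗ[A] TangentCone A}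
    (hΦ : ∀ (c : NoetherNorm x) (z : DecompModule x r α τ),
      Φ (c • z) = FiberRing.map (maximalIdeal A) hx c * Φ z) {n : ℕ}
    (hn : maximalIdeal A ^ n ≤ initialIdeal (LinearMap.range Φ) n) :
    Ideal.span {x} * maximalIdeal A ^ n ≤ initialIdeal (LinearMap.range Φ) (n + 1) := by
  intro b hb
  obtain ⟨a, ha, rfl⟩ := Ideal.mem_span_singleton_mul.1 hb
  obtain ⟨_, z, hz⟩ := mem_initialIdeal.1 (hn ha)
  have hmem : x * a ∈ maximalIdeal A ^ (n + 1) := by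
    rw [pow_succ']
    exact Ideal.mul_mem_mul (hx (Ideal.mem_span_singleton_self x)) ha
  refine mem_initialIdeal.2 ⟨hmem, initialForm x ^ 1 • z, ?_⟩
  rw [hΦ, hz, map_initialForm_pow, FiberRing.single_mul_single]
  exact FiberRing.single_congr (add_comm 1 n) (by simp)

theorem IsAlmostMinimalSystem.exists_hasTangentConeInvariants [IsNoetherianRing A] {e : ℕ}
    (he : HasMultiplicity A e) (h1 : hilbertFunction A 1 + 1 = e)
    (h2 : hilbertFunction A 2 + 1 = e) (h3 : ∀ n, 3 ≤ n → hilbertFunction A n = e) {y w h : A}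
    (S : IsAlmostMinimalSystem x y w h) (hx : Ideal.span {x} ≤ maximalIdeal A) :
    ∃ α τ, HasTangentConeInvariants x hx 3 α τ := by
  obtain ⟨d, hd, g, hg⟩ := exists_generators_maximalIdeal h1 S
  -- The default value 1 serves degrees 0, 2 and 3, with generators `1`, `w` and `y w`. The single
  -- torsion summand belongs to `h`.
  let α : ℕ → ℕ := fun i => if i = 1 then d else 1
  let τ : ℕ → ℕ → ℕ := fun i j => if i = 1 ∧ j = 1 then 1 else 0
  have hgm : ∀ k, g k ∈ maximalIdeal A := fun k => by
    rw [hg]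
    exact Submodule.mem_sup_right (Ideal.subset_span ⟨k, rfl⟩)
  -- Total functions of natural numbers avoid transports between `Fin (α i)` and `Fin d`; the zero
  -- values lie outside the ranges in use.
  let G : ℕ → ℕ → A := fun i k =>
    if i = 0 then 1 else if i = 1 then (if hk : k < d then g ⟨k, hk⟩ else 0)
    else if i = 2 then w else if i = 3 then y * w else 0
  have hG : ∀ i k, G i k ∈ maximalIdeal A ^ i := by
    intro i k
    simp only [G]
    split_ifs with h0 h1 hk h2 h3
    · simp [h0]
    · rw [h1, pow_one]
      exact hgm _
    · exact zero_mem _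
    · rw [h2, S.sq_eq]
      exact Submodule.mem_sup_right (Ideal.mem_span_singleton_self w)
    · rw [h3, S.cube_eq]
      exact Submodule.mem_sup_right (Ideal.mem_span_singleton_self _)
    · exact zero_mem _
  let H : ℕ → A := fun i => if i = 1 then h else 0
  have hH : ∀ i, H i ∈ maximalIdeal A ^ i := by
    intro i
    simp only [H]
    split_ifs with h1
    · rw [h1, pow_one]
      exact S.h_mem
    · exact zero_mem _
  have hxH : ∀ i j, 1 ≤ j → x ^ j * H i ∈ maximalIdeal A ^ (j + i + 1) := by
    intro i j hj
    obtain ⟨j, rfl⟩ := Nat.exists_eq_add_of_le' hj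
    simp only [H]
    split_ifs with h1
    -- The relation `x h = y w ∈ m^3` gains one degree, so `x*` annihilates the class of `h`.
    · rw [h1, pow_succ x j, mul_assoc, S.mul_h, show j + 1 + 1 + 1 = j + 3 by omega, pow_add]
      refine Ideal.mul_mem_mul (Ideal.pow_mem_pow S.x_mem j) ?_
      rw [S.cube_eq]
      exact Submodule.mem_sup_right (Ideal.mem_span_singleton_self _)
    · rw [mul_zero]
      exact zero_mem _
  obtain ⟨Φ, hΦ, hgr, hfree, htors⟩ := exists_gradedHom_tangentCone (r := 3) (α := α) (τ := τ) hx
    (fun p => ⟨G p.1 p.2, hG _ _⟩) (fun q => ⟨H q.1, hH _⟩)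
    (fun q => hxH _ _ (Finset.mem_Icc.1 q.2.1.2).1)
  refine ⟨α, τ, hasTangentConeInvariants_of_surjective hx Φ hΦ hgr ?_
    (hilbertFunction_ne_top he) fun n => ?_⟩
  · set Ψ := DecompModule.toLinearMap hx Φ hΦ
    have hx' : ∀ {n}, maximalIdeal A ^ n ≤ initialIdeal (LinearMap.range Ψ) n →
        Ideal.span {x} * maximalIdeal A ^ n ≤ initialIdeal (LinearMap.range Ψ) (n + 1) :=
      fun hn => span_singleton_mul_le_initialIdeal hΦ hn
    have hmemG : ∀ (i : Fin 4) (k : Fin (α i)), G i k ∈ initialIdeal (LinearMap.range Ψ) i :=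
      fun i k => mem_initialIdeal.2 ⟨hG _ _, hfree ⟨i, k⟩⟩
    have ht0 : maximalIdeal A ^ 0 ≤ initialIdeal (LinearMap.range Ψ) 0 := by
      have h0 : (1 : A) ∈ initialIdeal (LinearMap.range Ψ) 0 := hmemG 0 ⟨0, one_pos⟩
      rw [(Ideal.eq_top_iff_one _).2 h0]
      exact le_top
    have ht1 : maximalIdeal A ^ 1 ≤ initialIdeal (LinearMap.range Ψ) 1 := by
      rw [pow_one]
      nth_rewrite 1 [hg]
      refine sup_le (sup_le (sup_le (pow_succ_le_initialIdeal _ 1) ?_) ?_) ?_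
      · simpa using hx' ht0
      · rw [Ideal.span_singleton_le_iff_mem]
        exact mem_initialIdeal.2 ⟨hH 1, htors
          ⟨⟨1, by simp⟩, ⟨1, by simp⟩, ⟨0, by simp [τ]⟩⟩⟩
      · rw [Ideal.span_le]
        rintro _ ⟨k, rfl⟩
        have h : G 1 k ∈ initialIdeal (LinearMap.range Ψ) 1 := hmemG 1 k
        simpa [G] using h
    have ht2 : maximalIdeal A ^ 2 ≤ initialIdeal (LinearMap.range Ψ) 2 := by
      nth_rewrite 1 [S.sq_eq]
      refine sup_le (by simpa using hx' ht1) ?_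
      rw [Ideal.span_singleton_le_iff_mem]
      exact hmemG 2 ⟨0, one_pos⟩
    have ht3 : maximalIdeal A ^ 3 ≤ initialIdeal (LinearMap.range Ψ) 3 := by
      nth_rewrite 1 [S.cube_eq]
      refine sup_le (hx' ht2) ?_
      rw [Ideal.span_singleton_le_iff_mem]
      exact hmemG 3 ⟨0, one_pos⟩
    have ht : ∀ n, 3 ≤ n → maximalIdeal A ^ n ≤ initialIdeal (LinearMap.range Ψ) n := by
      intro n hn
      induction n, hn using Nat.le_induction with
      | base => exact ht3
      | succ n hn ih =>
        rw [S.pow_succ_eq hn]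
        exact hx' ih
    refine LinearMap.range_eq_top.1 (eq_top_of_pow_le_initialIdeal (N := LinearMap.range Ψ) ?_)
    intro n
    rcases Nat.lt_or_ge n 3 with hn | hn
    · interval_cases n
      exacts [ht0, ht1, ht2]
    · exact ht n hn
  · rw [DecompModule.length_range_monomialMap S.nonZeroDivisors,
      sum_freeIndex 3 α fun i => if i ≤ n then (1 : ℕ∞) else 0,
      sum_torsionIndex 3 τ fun i j => if i ≤ n ∧ n - i < j then (1 : ℕ∞) else 0]
    have hI1 : Finset.Icc 1 (3 - 1) = {1, 2} := rfl
    have hI2 : Finset.Icc 1 (3 - 2) = {1} := rfl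
    rw [hI1, Finset.sum_pair (by norm_num), hI1, hI2, Finset.sum_pair (by norm_num),
      Finset.sum_singleton]
    -- The counts in degrees 0, 1, 2 and from 3 on are `1`, `d + 2`, `d + 2`, `d + 3`: `h` counts
    -- only in degree 1, `w` from degree 2 and `y w` from degree 3.
    simp only [Finset.sum_range_succ, Finset.sum_range_zero, α, τ]
    rcases Nat.lt_or_ge n 3 with hn | hn
    · obtain ⟨k1, hk1⟩ := ENat.ne_top_iff_exists.1 (hilbertFunction_ne_top he 1)
      obtain ⟨k2, hk2⟩ := ENat.ne_top_iff_exists.1 (hilbertFunction_ne_top he 2)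
      rw [← hk1] at h1
      rw [← hk2] at h2
      norm_cast at h1 h2
      interval_cases n
      · simp [hilbertFunction_zero]
      · rw [← hk1]
        obtain rfl : k1 = 1 + d + 1 := by omega
        simp
      · rw [← hk2]
        obtain rfl : k2 = 1 + d + 1 := by omega
        simp
    · rw [h3 n hn, ← hd]
      have h4 : 1 ≤ n := by omega
      have h5 : 2 ≤ n := by omega
      have h6 : ¬ n - 1 < 1 := by omega
      simp [h4, h5, h6, hn]
      norm_cast
      omega

theorem IsAlmostMinimalSystem.tangentConeInvariants_eq [IsNoetherianRing A] {e : ℕ}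
    (he : HasMultiplicity A e) (h2 : hilbertFunction A 2 + 1 = e)
    (h3 : hilbertFunction A 3 = e) {y w h : A}
    (S : IsAlmostMinimalSystem x y w h) {hx : Ideal.span {x} ≤ maximalIdeal A}
    (hατ : HasTangentConeInvariants x hx 3 α τ) :
    (α 1 : ℤ) = (e : ℤ) - 3 ∧ α 2 = 1 ∧ α 3 = 1 := by
  have key : ∀ s k, ∑ i ∈ Finset.range (3 + 1), α i • (if i ≤ s then (1 : ℕ∞) else 0) +
      ∑ i ∈ Finset.Icc 1 (3 - 1), ∑ j ∈ Finset.Icc 1 (3 - i),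
        τ i j • (if i ≤ s ∧ s + k - i < j then (1 : ℕ∞) else 0) =
      relLength (Ideal.span {x ^ k} * maximalIdeal A ^ s ⊔ maximalIdeal A ^ (s + k + 1))
        (maximalIdeal A ^ (s + k + 1)) := by
    intro s k
    rw [← length_range_monomialMap_of_hasTangentConeInvariants hατ,
      DecompModule.length_range_monomialMap S.nonZeroDivisors,
      sum_freeIndex 3 α fun i => if i ≤ s then (1 : ℕ∞) else 0,
      sum_torsionIndex 3 τ fun i j => if i ≤ s ∧ s + k - i < j then (1 : ℕ∞) else 0]
  have hI1 : Finset.Icc 1 (3 - 1) = {1, 2} := rfl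
  have hI2 : Finset.Icc 1 (3 - 2) = {1} := rfl
  simp only [hI1, Finset.sum_pair (show (1 : ℕ) ≠ 2 by norm_num), hI2, Finset.sum_singleton,
    Finset.sum_range_succ, Finset.sum_range_zero] at key
  have hzero : ∀ n, relLength (Ideal.span {x ^ 0} * maximalIdeal A ^ n ⊔ maximalIdeal A ^ (n + 1))
      (maximalIdeal A ^ (n + 1)) = hilbertFunction A n := by
    intro n
    rw [pow_zero, Ideal.span_singleton_one, ← Ideal.one_eq_top, one_mul,
      sup_eq_left.2 (Ideal.pow_le_pow_right n.le_succ), hilbertFunction]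
  have hle1 : Ideal.span {x} * maximalIdeal A ≤ maximalIdeal A ^ 2 := by
    rw [pow_two]
    exact Ideal.mul_mono_left S.reduction.1
  have hle2 : Ideal.span {x} * maximalIdeal A ^ 2 ≤ maximalIdeal A ^ 3 := by
    rw [pow_succ' _ 2]
    exact Ideal.mul_mono_left S.reduction.1
  -- Here `m^3 ⊆ x m ⊆ m^2` with `λ(m^2 / x m) = 1`, so `x* G_1` has length `H(2) - 1`.
  have hl1 : relLength (Ideal.span {x ^ 1} * maximalIdeal A ^ 1 ⊔ maximalIdeal A ^ (1 + 1 + 1))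
      (maximalIdeal A ^ (1 + 1 + 1)) + 2 = e := by
    have h := relLength_add_relLength S.cube_le hle1
    rw [S.relLength_sq] at h
    rw [pow_one, pow_one, sup_eq_left.2 S.cube_le, ← h2, ← one_add_one_eq_two, ← add_assoc,
      add_comm _ (1 : ℕ∞), hilbertFunction, ← h]
    exact (add_assoc _ _ _).symm
  have hl2 : relLength (Ideal.span {x ^ 1} * maximalIdeal A ^ 2 ⊔ maximalIdeal A ^ (2 + 1 + 1))
      (maximalIdeal A ^ (2 + 1 + 1)) + 1 = e := by
    have h4 : maximalIdeal A ^ 4 ≤ Ideal.span {x} * maximalIdeal A ^ 2 := by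
      rw [S.pow_four]
      exact Ideal.mul_mono_right (Ideal.pow_le_pow_right (by omega))
    have h := relLength_add_relLength h4 hle2
    have h' := hilbertFunction_add_relLength he S.nonZeroDivisors S.reduction 2
    rw [← h2] at h'
    rw [WithTop.add_left_cancel (hilbertFunction_ne_top he 2) h'] at h
    rw [pow_one, sup_eq_left.2 h4, add_comm, ← h3]
    exact h
  -- The five counts read `α_0 = 1`, `α_0 + α_1 + τ_12 = e - 2`, `α_0 + α_1 + α_2 = e - 1`, the same
  -- sum plus `τ_12 + τ_21` again equal to `e - 1`, and `α_0 + α_1 + α_2 + α_3 = e`. The third and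
  -- fourth force `τ_12 = τ_21 = 0`.
  have k0 := key 0 0
  have k1 := key 1 1
  have k2 := key 2 1
  have k3 := key 2 0
  have k4 := key 3 0
  rw [hzero, hilbertFunction_zero] at k0
  rw [← k1] at hl1
  rw [← k2] at hl2
  rw [hzero] at k3
  rw [hzero, h3] at k4
  rw [← k3] at h2
  simp at k0 hl1 hl2 h2 k4
  norm_cast at k0 hl1 hl2 h2 k4
  omega

end Existence

/-! ### The main theorem -/

theorem mainTheorem10 {A : Type*} [CommRing A] [IsLocalRing A] [IsNoetherianRing A]
    [Infinite (IsLocalRing.ResidueField A)]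
    (hdim : ringKrullDim A = 1) (hCM : IsCohenMacaulayLocal A)
    (e : ℕ) (he : HasAlmostMinimalMultiplicity A e) (hr : HasReductionNumber A 3)
    (x : A) (hx : IsMinimalReduction (IsLocalRing.maximalIdeal A) (Ideal.span {x})) :
    ((∃ (α : ℕ → ℕ) (τ : ℕ → ℕ → ℕ), HasTangentConeInvariants x hx.le 3 α τ) ∧
      ∀ (α : ℕ → ℕ) (τ : ℕ → ℕ → ℕ), HasTangentConeInvariants x hx.le 3 α τ →
        (α 1 : ℤ) = (e : ℤ) - 3 ∧ α 2 = 1 ∧ α 3 = 1) ∧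
    (IsMicroInvariant A 1 ((e : ℤ) - 3) ∧ IsMicroInvariant A 2 2 ∧ IsMicroInvariant A 3 0) ∧
    (aperyInvariant x 1 + 2 = (e : ℕ∞) ∧ aperyInvariant x 2 = 1 ∧ aperyInvariant x 3 = 0) := by
  obtain ⟨he, heb⟩ := he
  have hnzd := mem_nonZeroDivisors_of_isIdealReduction hdim hCM hx.prop
  obtain ⟨hge, hlt⟩ := hilbertFunction_eq_of_hasReductionNumber hdim hCM he hr
  have h1 : hilbertFunction A 1 + 1 = e := by
    rw [hilbertFunction_one, heb]
    norm_cast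
  obtain ⟨⟨y, w, h, S⟩, h2⟩ := exists_isAlmostMinimalSystem he h1 (hlt 2 (by norm_num))
    (hge 3 le_rfl) hnzd hx.prop
  exact ⟨⟨S.exists_hasTangentConeInvariants he h1 h2 hge hx.le,
    fun α τ hατ => S.tangentConeInvariants_eq he h2 (hge 3 le_rfl) hατ⟩,
    microInvariant_of_isAlmostMinimalSystem he h1 h2 (hge 3 le_rfl) S,
    aperyInvariant_of_isAlmostMinimalSystem he h1 S⟩
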